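/- Let $n\ge 2$ and $q\in(0,\infty)$, and let $w$ be a random permutation in $S_n$ with the Mallows distribution of parameter $q$, that is, $\mathbf P(w=w_0)=q^{l(w_0)}/\sum_{v\in S_n}q^{l(v)}$ for every $w_0\in S_n$, where $l(v)$ is the number of inversions of $v$ (pairs $i<j$ with $v(i)>v(j)$). Let $\operatorname{des}(v)$ be the number of descents of $v$ (indices $1\le i\le n-1$ with $v(i)>v(i+1)$), and let $\mu$ and $\sigma^2$ (with $\sigma\ge 0$) denote the mean and variance of $\operatorname{des}(w)+\operatorname{des}(w^{-1})$. Let $Z$ be a standard normal random variable. Then for every piecewise continuously differentiable function $h:\mathbf R\to\mathbf R$ (that is, $h$ is continuous, and is continuously differentiable off a set with only finitely many points in each bounded interval), $$\left|\mathbf E\,h\!\left(\frac{\operatorname{des}(w)+\operatorname{des}(w^{-1})-\mu}{\sigma}\right)-\mathbf E\,h(Z)\right|\le\left(331\,\|h\|_\infty+167\,\|h'\|_\infty\max(q^{-1/2},q^{1/2})\right)(n-1)^{-1/2}.$$ Here $\|h\|_\infty$ is the supremum of $|h|$ and $\|h'\|_\infty$ is the supremum of $|h'|$ over the points where $h$ is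 differentiable; if either is infinite, the right-hand side is $+\infty$ and the bound is void. -/

import Mathlib

open MeasureTheory ProbabilityTheory
open scoped ENNReal

namespace Mallows

/-- The number of inversions of `w` (its length): pairs of positions `i < j` with `w i > w j`. -/
def inversions {n : ℕ} (w : Equiv.Perm (Fin n)) : ℕ :=
  (Finset.univ.filter fun p : Fin n × Fin n => p.1 < p.2 ∧ w p.2 < w p.1).card

/-- The number of descents of `w`: pairs of consecutive positions `i, i + 1` with
`w i > w (i + 1)`. -/
def des {n : ℕ} (w : Equiv.Perm (Fin n)) : ℕ :=
  (Finset.univ.filter fun p : Fin n × Fin n => (p.1 : ℕ) + 1 = p.2 ∧ w p.2 < w p.1).card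

/-- The two-sided descent statistic `des w + des w⁻¹`, as a real number. -/
def twoSidedDes {n : ℕ} (w : Equiv.Perm (Fin n)) : ℝ :=
  (des w : ℝ) + (des w⁻¹ : ℝ)

/-- The finite set of permutations of `Fin n` carries the discrete σ-algebra. -/
instance instMeasurableSpacePermFin (n : ℕ) : MeasurableSpace (Equiv.Perm (Fin n)) := ⊤

/-- The normalization constant, the sum of `q ^ inversions w` over all permutations. -/
noncomputable def partitionFunction (n : ℕ) (q : ℝ) : ℝ :=
  ∑ w : Equiv.Perm (Fin n), q ^ inversions w

/-- The Mallows distribution with parameter `q`: the permutation `w` has mass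
`q ^ inversions w / partitionFunction n q`. -/
noncomputable def mallowsMeasure (n : ℕ) (q : ℝ) : Measure (Equiv.Perm (Fin n)) :=
  ∑ w : Equiv.Perm (Fin n),
    ENNReal.ofReal (q ^ inversions w / partitionFunction n q) • Measure.dirac w

theorem partitionFunction_pos (n : ℕ) {q : ℝ} (hq : 0 < q) : 0 < partitionFunction n q :=
  Finset.sum_pos (fun _ _ => pow_pos hq _) Finset.univ_nonempty

/-- For `q > 0` the Mallows distribution is a probability measure. -/
theorem isProbabilityMeasure_mallowsMeasure (n : ℕ) {q : ℝ} (hq : 0 < q) :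
    IsProbabilityMeasure (mallowsMeasure n q) := by
  have hZ := partitionFunction_pos n hq
  constructor
  simp only [mallowsMeasure, Measure.coe_finsetSum, Measure.coe_smul, Finset.sum_apply,
    Pi.smul_apply, measure_univ, smul_eq_mul, mul_one]
  rw [← ENNReal.ofReal_sum_of_nonneg (fun w _ => by positivity), ← Finset.sum_div]
  rw [show ∑ w : Equiv.Perm (Fin n), q ^ inversions w = partitionFunction n q from rfl,
    div_self hZ.ne', ENNReal.ofReal_one]

/-- Piecewise continuously differentiable functions on the line: `h` is continuous, and is `C¹`
off some set of breakpoints that has only finitely many points in each bounded interval.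
One-sided limits of `h'` at the breakpoints are not required, so this covers the usual
variants of the notion. -/
def IsPiecewiseC1 (h : ℝ → ℝ) : Prop :=
  Continuous h ∧
    ∃ S : Set ℝ, (∀ a b : ℝ, (S ∩ Set.Icc a b).Finite) ∧ ContDiffOn ℝ 1 h Sᶜ

/-- The supremum norm of `h`, possibly infinite. -/
noncomputable def supNorm (h : ℝ → ℝ) : ℝ≥0∞ :=
  ⨆ x : ℝ, ‖h x‖ₑ

/-- The supremum norm of `h'`, possibly infinite; the supremum is over the points at which `h` is
differentiable. -/
noncomputable def supNormDeriv (h : ℝ → ℝ) : ℝ≥0∞ :=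
  ⨆ (x : ℝ) (_ : DifferentiableAt ℝ h x), ‖deriv h x‖ₑ

end Mallows

/-!
The proof is Stein's method with a size-bias coupling.

**Coupling.** For a Mallows permutation `w`, swapping the values at an ascent `i, i + 1` multiplies
the weight by `q`, so sorting the values at these positions into decreasing order produces the law
of `w` conditioned on a descent there. As inversion preserves both the distribution and the
statistic `W = des w + des w⁻¹`, descents of `w⁻¹` need no separate coupling, and with
`p = q / (1 + q)` and `m = n - 1`,
`E[(W - μ) F(W)] = 2 p ∑ i, E[F(W + Δ i) - F(W)]`, where `Δ i` is the `increment` at `i`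
(`mallowsMean_twoSidedDes_sub`). The choice `F(x) = x - μ` gives `σ² = 2 p E[∑ i, Δ i]`.
An adjacent swap changes `des w` only through the neighbours, and `des w⁻¹` only if the two values
are consecutive, whence `|Δ i| ≤ 2` and an explicit formula (`increment_eq`). The ratios `1 : q : q²`
between patterns of three consecutive positions show `E[Δ i] ≥ 1 / (3 (1 + q))`, which also bounds
the variance from below.

**Variance of the conditional increment.** The sum `∑ i, Δ i` is a sum over triples of consecutive
values of local pattern counts and of the number of successions `w (i + 1) = w i + 1`. Its variance
is bounded by exposing the values one at a time (`mallowsVar_le_of_consPerm`): prescribing a first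
value of rank `a` changes the conditional mean by a bounded amount plus the expected number of
successions among the `a` smallest remaining values, since above rank `a` only a shift of the index
takes place. Each such succession has probability at most `2 / [n]` (`mallowsMean_succession_le`),
while the rank `a` is truncated geometric with second moment at most `2 [n + 1]²`
(`firstMean_sq_le`), where `[n] = 1 + q + ⋯ + q ^ (n - 1)`. Hence the variance is at most `136 m`,
uniformly in `q ≤ 1`.

**Stein equation.** For bounded `h` with Lipschitz constant `K`, the solution `f` of
`f' x - x f x = h x - E h(Z)` satisfies `|f'| ≤ 4 ‖h‖`, and `f'` is Lipschitz with constant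
`26 K / 5`, by elementary estimates of the Mills ratio (`exists_stein_solution`). Inserting the
Taylor expansion of `f` into the size-bias identity yields the two error terms
(`abs_mallowsMean_stein_le`). All this is for `q ≤ 1`; reversing the permutation exchanges `q`
with `q⁻¹` and `W` with `2 m - W`.
-/

namespace Mallows

/-! ### Building permutations from their first value -/

/-- The permutation of `Fin (n + 1)` whose first value is `a` and whose remaining values are in the
same relative order as those of `v`. -/
def consPerm {n : ℕ} (a : Fin (n + 1)) (v : Equiv.Perm (Fin n)) : Equiv.Perm (Fin (n + 1)) :=
  (finSuccEquiv' 0).trans ((Equiv.optionCongr v).trans (finSuccEquiv' a).symm)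

@[simp]
theorem consPerm_zero {n : ℕ} (a : Fin (n + 1)) (v : Equiv.Perm (Fin n)) :
    consPerm a v 0 = a := by
  simp [consPerm]

@[simp]
theorem consPerm_succ {n : ℕ} (a : Fin (n + 1)) (v : Equiv.Perm (Fin n)) (i : Fin n) :
    consPerm a v i.succ = a.succAbove (v i) := by
  have : finSuccEquiv' (0 : Fin (n + 1)) i.succ = some i := by
    simp
  simp [consPerm, this]

theorem consPerm_injective (n : ℕ) :
    Function.Injective (fun x : Fin (n + 1) × Equiv.Perm (Fin n) => consPerm x.1 x.2) := by
  rintro ⟨a, v⟩ ⟨b, u⟩ h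
  have hab : a = b := by simpa using congrArg (fun w : Equiv.Perm (Fin (n + 1)) => w 0) h
  subst hab
  have hvu : v = u := by
    ext1 i
    have := congrArg (fun w : Equiv.Perm (Fin (n + 1)) => w i.succ) h
    simpa using this
  rw [hvu]

/-- A permutation of `Fin (n + 1)` amounts to its first value together with the pattern of its
remaining values. -/
noncomputable def consPermEquiv (n : ℕ) :
    Fin (n + 1) × Equiv.Perm (Fin n) ≃ Equiv.Perm (Fin (n + 1)) :=
  Equiv.ofBijective (fun x => consPerm x.1 x.2) <| by
    rw [Fintype.bijective_iff_injective_and_card]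
    refine ⟨consPerm_injective n, ?_⟩
    simp [Fintype.card_perm, Nat.factorial_succ]

theorem inversions_eq_sum {n : ℕ} (w : Equiv.Perm (Fin n)) :
    inversions w = ∑ i, ∑ j, if i < j ∧ w j < w i then 1 else 0 := by
  rw [inversions, Finset.card_filter, Fintype.sum_prod_type]

theorem inversions_consPerm {n : ℕ} (a : Fin (n + 1)) (v : Equiv.Perm (Fin n)) :
    inversions (consPerm a v) = a + inversions v := by
  rw [inversions_eq_sum, inversions_eq_sum, Fin.sum_univ_succ]
  congr 1
  · rw [Fin.sum_univ_succ]
    simp only [lt_irrefl, false_and, if_false, zero_add, Fin.succ_pos, true_and, consPerm_zero,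
      consPerm_succ]
    rw [Equiv.sum_comp v (fun j => if a.succAbove j < a then 1 else 0), ← Finset.card_filter]
    simp only [Fin.succAbove_lt_iff_castSucc_lt]
    have : (Finset.univ.filter fun j : Fin n => j.castSucc < a)
        = Finset.univ.filter fun j : Fin n => (j : ℕ) < a := by
      ext j; simp [Fin.lt_def]
    rw [this, Fin.card_filter_val_lt]
    exact min_eq_right (by omega)
  · refine Finset.sum_congr rfl fun i _ => ?_
    rw [Fin.sum_univ_succ]
    simp

theorem inversions_inv {n : ℕ} (w : Equiv.Perm (Fin n)) : inversions w⁻¹ = inversions w := by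
  unfold inversions
  refine Finset.card_nbij' (fun p => (w⁻¹ p.2, w⁻¹ p.1)) (fun p => (w p.2, w p.1)) ?_ ?_ ?_ ?_
  · rintro ⟨i, j⟩; simp; tauto
  · rintro ⟨i, j⟩; simp; tauto
  · rintro ⟨i, j⟩; simp
  · rintro ⟨i, j⟩; simp

/-- Conjugation by the order-reversing permutation does not change the number of inversions. -/
theorem inversions_rev_conj {n : ℕ} (w : Equiv.Perm (Fin n)) :
    inversions (Fin.revPerm * w * Fin.revPerm) = inversions w := by
  unfold inversions
  refine Finset.card_nbij' (fun p => (p.2.rev, p.1.rev)) (fun p => (p.2.rev, p.1.rev)) ?_ ?_ ?_ ?_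
  · rintro ⟨i, j⟩; simp
  · rintro ⟨i, j⟩; simp
  · rintro ⟨i, j⟩; simp
  · rintro ⟨i, j⟩; simp

theorem inversions_mul_rev {n : ℕ} (w : Equiv.Perm (Fin n)) :
    inversions (w * Fin.revPerm) + inversions w
      = (Finset.univ.filter fun p : Fin n × Fin n => p.1 < p.2).card := by
  have h : inversions (w * Fin.revPerm)
      = (Finset.univ.filter fun p : Fin n × Fin n => p.1 < p.2 ∧ w p.1 < w p.2).card := by
    unfold inversions
    refine Finset.card_nbij' (fun p => (p.2.rev, p.1.rev)) (fun p => (p.2.rev, p.1.rev)) ?_ ?_ ?_ ?_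
    · rintro ⟨i, j⟩; simp
    · rintro ⟨i, j⟩; simp
    · rintro ⟨i, j⟩; simp
    · rintro ⟨i, j⟩; simp
  rw [h, inversions, ← Finset.card_union_of_disjoint]
  · congr 1
    ext ⟨i, j⟩
    simp only [Finset.mem_union, Finset.mem_filter, Finset.mem_univ, true_and]
    constructor
    · tauto
    · intro hij
      have : w i ≠ w j := fun h => hij.ne (w.injective h)
      rcases lt_or_gt_of_ne this with h | h <;> tauto
  · rw [Finset.disjoint_left]
    rintro ⟨i, j⟩
    simp only [Finset.mem_filter, Finset.mem_univ, true_and]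
    intro h1 h2
    exact lt_asymm h1.2 h2.2

/-! ### Expectations under the Mallows distribution -/

/-- The expectation of `g` under the Mallows distribution with parameter `q`, as a finite sum. -/
noncomputable def mallowsMean (n : ℕ) (q : ℝ) (g : Equiv.Perm (Fin n) → ℝ) : ℝ :=
  (∑ w, q ^ inversions w * g w) / partitionFunction n q

theorem mallowsMean_add (n : ℕ) (q : ℝ) (f g : Equiv.Perm (Fin n) → ℝ) :
    mallowsMean n q (fun w => f w + g w) = mallowsMean n q f + mallowsMean n q g := by
  simp only [mallowsMean, mul_add, Finset.sum_add_distrib, add_div]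

theorem mallowsMean_sub (n : ℕ) (q : ℝ) (f g : Equiv.Perm (Fin n) → ℝ) :
    mallowsMean n q (fun w => f w - g w) = mallowsMean n q f - mallowsMean n q g := by
  simp only [mallowsMean, mul_sub, Finset.sum_sub_distrib, sub_div]

theorem mallowsMean_const_mul (n : ℕ) (q c : ℝ) (g : Equiv.Perm (Fin n) → ℝ) :
    mallowsMean n q (fun w => c * g w) = c * mallowsMean n q g := by
  simp only [mallowsMean, mul_left_comm _ c, ← Finset.mul_sum, mul_div_assoc]

theorem mallowsMean_sum {ι : Type*} (s : Finset ι) (n : ℕ) (q : ℝ)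
    (g : ι → Equiv.Perm (Fin n) → ℝ) :
    mallowsMean n q (fun w => ∑ i ∈ s, g i w) = ∑ i ∈ s, mallowsMean n q (g i) := by
  simp only [mallowsMean, Finset.mul_sum, ← Finset.sum_div]
  rw [Finset.sum_comm]

theorem mallowsMean_const (n : ℕ) {q : ℝ} (hq : 0 < q) (c : ℝ) :
    mallowsMean n q (fun _ => c) = c := by
  rw [mallowsMean, ← Finset.sum_mul]
  exact mul_div_cancel_left₀ c (partitionFunction_pos n hq).ne'

theorem mallowsMean_mono (n : ℕ) {q : ℝ} (hq : 0 < q) {f g : Equiv.Perm (Fin n) → ℝ}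
    (h : ∀ w, f w ≤ g w) : mallowsMean n q f ≤ mallowsMean n q g := by
  unfold mallowsMean
  have := partitionFunction_pos n hq
  gcongr with w
  exact h w

theorem mallowsMean_nonneg (n : ℕ) {q : ℝ} (hq : 0 < q) {g : Equiv.Perm (Fin n) → ℝ}
    (h : ∀ w, 0 ≤ g w) : 0 ≤ mallowsMean n q g := by
  simpa [mallowsMean_const n hq] using mallowsMean_mono n hq (f := fun _ => 0) h

theorem abs_mallowsMean_le (n : ℕ) {q : ℝ} (hq : 0 < q) (g : Equiv.Perm (Fin n) → ℝ) :
    |mallowsMean n q g| ≤ mallowsMean n q (fun w => |g w|) := by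
  rw [abs_le]
  constructor
  · have := mallowsMean_mono n hq (f := fun w => (-1) * |g w|) (g := g)
      (fun w => by linarith [neg_abs_le (g w)])
    rw [mallowsMean_const_mul] at this
    linarith
  · exact mallowsMean_mono n hq fun w => le_abs_self _

theorem mallowsMean_mul_sq_le (n : ℕ) {q : ℝ} (hq : 0 < q) (f g : Equiv.Perm (Fin n) → ℝ) :
    mallowsMean n q (fun w => f w * g w) ^ 2
      ≤ mallowsMean n q (fun w => f w ^ 2) * mallowsMean n q (fun w => g w ^ 2) := by
  have hZ := partitionFunction_pos n hq
  unfold mallowsMean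
  rw [div_pow, div_mul_div_comm, ← sq]
  gcongr
  have := Finset.sum_mul_sq_le_sq_mul_sq Finset.univ
    (fun w => Real.sqrt (q ^ inversions w) * f w) (fun w => Real.sqrt (q ^ inversions w) * g w)
  have hs : ∀ w : Equiv.Perm (Fin n),
      Real.sqrt (q ^ inversions w) * Real.sqrt (q ^ inversions w) = q ^ inversions w :=
    fun w => Real.mul_self_sqrt (by positivity)
  calc (∑ w, q ^ inversions w * (f w * g w)) ^ 2
      = (∑ w, Real.sqrt (q ^ inversions w) * f w * (Real.sqrt (q ^ inversions w) * g w)) ^ 2 := by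
        congr 1
        exact Finset.sum_congr rfl fun w _ => by linear_combination (-(f w * g w)) * hs w
    _ ≤ _ := this
    _ = _ := by
        congr 1
        · exact Finset.sum_congr rfl fun w _ => by linear_combination (f w ^ 2) * hs w
        · exact Finset.sum_congr rfl fun w _ => by linear_combination (g w ^ 2) * hs w

theorem mallowsMean_comp_equiv {n : ℕ} (q : ℝ) (e : Equiv.Perm (Fin n) ≃ Equiv.Perm (Fin n))
    (he : ∀ w, inversions (e w) = inversions w) (g : Equiv.Perm (Fin n) → ℝ) :
    mallowsMean n q (fun w => g (e w)) = mallowsMean n q g := by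
  unfold mallowsMean
  congr 1
  rw [← Equiv.sum_comp e (fun w => q ^ inversions w * g w)]
  simp only [he]

theorem mallowsMean_inv (n : ℕ) (q : ℝ) (g : Equiv.Perm (Fin n) → ℝ) :
    mallowsMean n q (fun w => g w⁻¹) = mallowsMean n q g :=
  mallowsMean_comp_equiv q (Equiv.inv _) inversions_inv g

theorem mallowsMean_rev_conj (n : ℕ) (q : ℝ) (g : Equiv.Perm (Fin n) → ℝ) :
    mallowsMean n q (fun w => g (Fin.revPerm * w * Fin.revPerm)) = mallowsMean n q g :=
  mallowsMean_comp_equiv q ((Equiv.mulLeft Fin.revPerm).trans (Equiv.mulRight Fin.revPerm))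
    inversions_rev_conj g

/-- Reversing a Mallows permutation replaces `q` by `q⁻¹`. -/
theorem mallowsMean_mul_rev (n : ℕ) {q : ℝ} (hq : 0 < q) (g : Equiv.Perm (Fin n) → ℝ) :
    mallowsMean n q⁻¹ (fun w => g (w * Fin.revPerm)) = mallowsMean n q g := by
  set N := (Finset.univ.filter fun p : Fin n × Fin n => p.1 < p.2).card
  have key : ∀ f : Equiv.Perm (Fin n) → ℝ, ∑ w, q ^ inversions w * f w
      = q ^ N * ∑ w, q⁻¹ ^ inversions w * f (w * Fin.revPerm) := by
    intro f
    rw [← Equiv.sum_comp (Equiv.mulRight Fin.revPerm) (fun w => q ^ inversions w * f w),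
      Finset.mul_sum]
    refine Finset.sum_congr rfl fun w _ => ?_
    have h := inversions_mul_rev w
    simp only [Equiv.coe_mulRight]
    rw [show N = inversions (w * Fin.revPerm) + inversions w from h.symm, pow_add, inv_pow]
    field_simp
  unfold mallowsMean partitionFunction
  have h1 := key (fun _ => 1)
  simp only [mul_one] at h1
  rw [key g, h1, mul_div_mul_left _ _ (by positivity)]

/-! ### `q`-integers -/

/-- The `q`-integer `1 + q + ⋯ + q ^ (n - 1)`. -/
noncomputable def qInt (q : ℝ) (n : ℕ) : ℝ :=
  ∑ i ∈ Finset.range n, q ^ i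

theorem qInt_succ (q : ℝ) (n : ℕ) : qInt q (n + 1) = 1 + q * qInt q n := by
  rw [qInt, Finset.sum_range_succ', qInt, Finset.mul_sum]
  simp only [pow_succ, pow_zero]
  rw [add_comm]
  congr 1
  exact Finset.sum_congr rfl fun i _ => mul_comm _ _

theorem qInt_nonneg {q : ℝ} (hq : 0 < q) (n : ℕ) : 0 ≤ qInt q n :=
  Finset.sum_nonneg fun _ _ => by positivity

theorem one_le_qInt_succ {q : ℝ} (hq : 0 < q) (n : ℕ) : 1 ≤ qInt q (n + 1) := by
  rw [qInt_succ]
  nlinarith [qInt_nonneg hq n]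

theorem qInt_pos {q : ℝ} (hq : 0 < q) {n : ℕ} (hn : 0 < n) : 0 < qInt q n := by
  obtain ⟨k, rfl⟩ := Nat.exists_eq_succ_of_ne_zero hn.ne'
  linarith [one_le_qInt_succ hq k]

theorem one_sub_mul_qInt (q : ℝ) (n : ℕ) : (1 - q) * qInt q n = 1 - q ^ n := by
  induction n with
  | zero => simp [qInt]
  | succ n ih => rw [qInt_succ]; linear_combination q * ih

theorem qInt_add_le {q : ℝ} (hq : 0 < q) (hq1 : q ≤ 1) (m n : ℕ) :
    qInt q (m + n) ≤ qInt q m + qInt q n := by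
  rw [qInt, Finset.sum_range_add]
  unfold qInt
  refine add_le_add le_rfl (Finset.sum_le_sum fun i _ => ?_)
  rw [pow_add]
  exact mul_le_of_le_one_left (by positivity) (pow_le_one₀ hq.le hq1)

theorem sum_pow_mul_self_le {q : ℝ} (hq : 0 < q) (n : ℕ) :
    ∑ i ∈ Finset.range n, q ^ i * (i : ℝ) ≤ qInt q n ^ 2 := by
  induction n with
  | zero => simp [qInt]
  | succ n ih =>
    have h1 : ∑ i ∈ Finset.range (n + 1), q ^ i * (i : ℝ)
        = q * (∑ i ∈ Finset.range n, q ^ i * (i : ℝ) + qInt q n) := by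
      rw [Finset.sum_range_succ', qInt, ← Finset.sum_add_distrib, Finset.mul_sum]
      simp only [Nat.cast_zero, mul_zero, add_zero]
      refine Finset.sum_congr rfl fun i _ => ?_
      push_cast; ring
    have h2 := one_sub_mul_qInt q n
    have h3 := qInt_nonneg hq n
    have h4 : (0 : ℝ) ≤ q ^ n := by positivity
    have h5 : q * qInt q n * ((1 - q) * qInt q n) ≤ q * qInt q n * 1 := by
      rw [h2]; gcongr; linarith
    rw [h1, qInt_succ]
    nlinarith [mul_le_mul_of_nonneg_left ih hq.le, mul_nonneg hq.le h3]

/-- The second moment of the truncated geometric weights is at most of the order of the square of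
the total mass, uniformly in `q`. -/
theorem sum_pow_mul_sq_le {q : ℝ} (hq : 0 < q) (n : ℕ) :
    ∑ i ∈ Finset.range n, q ^ i * (i : ℝ) ^ 2 ≤ 2 * qInt q n ^ 3 := by
  induction n with
  | zero => simp [qInt]
  | succ n ih =>
    have h1 : ∑ i ∈ Finset.range (n + 1), q ^ i * (i : ℝ) ^ 2
        = q * (∑ i ∈ Finset.range n, q ^ i * (i : ℝ) ^ 2
          + 2 * ∑ i ∈ Finset.range n, q ^ i * (i : ℝ) + qInt q n) := by
      rw [Finset.sum_range_succ', qInt, Finset.mul_sum, ← Finset.sum_add_distrib,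
        ← Finset.sum_add_distrib, Finset.mul_sum]
      simp only [Nat.cast_zero, ne_eq, OfNat.ofNat_ne_zero, not_false_eq_true, zero_pow, mul_zero,
        add_zero]
      refine Finset.sum_congr rfl fun i _ => ?_
      push_cast; ring
    have h2 := one_sub_mul_qInt q n
    have h3 := qInt_nonneg hq n
    have h4 : (0 : ℝ) ≤ q ^ n := by positivity
    have h6 := sum_pow_mul_self_le hq n
    set Q := qInt q n
    set x := q * Q with hx
    have hx0 : 0 ≤ x := by positivity
    have hQ : Q ≤ 1 + x := by linarith
    have hQ2 : Q ^ 2 ≤ (1 + x) ^ 2 := by gcongr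
    rw [h1, qInt_succ]
    calc q * (∑ i ∈ Finset.range n, q ^ i * (i : ℝ) ^ 2
          + 2 * ∑ i ∈ Finset.range n, q ^ i * (i : ℝ) + Q)
        ≤ q * (2 * Q ^ 3 + 2 * Q ^ 2 + Q) := by gcongr
      _ = x * (2 * Q ^ 2 + 2 * Q + 1) := by rw [hx]; ring
      _ ≤ x * (2 * (1 + x) ^ 2 + 2 * (1 + x) + 1) := by gcongr
      _ ≤ 2 * (1 + x) ^ 3 := by nlinarith

/-! ### Conditioning on the first value -/

theorem sum_consPerm {n : ℕ} (q : ℝ) (g : Equiv.Perm (Fin (n + 1)) → ℝ) :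
    ∑ w, q ^ inversions w * g w
      = ∑ a : Fin (n + 1), q ^ (a : ℕ) * ∑ v, q ^ inversions v * g (consPerm a v) := by
  rw [← Equiv.sum_comp (consPermEquiv n), Fintype.sum_prod_type]
  refine Finset.sum_congr rfl fun a _ => ?_
  rw [Finset.mul_sum]
  refine Finset.sum_congr rfl fun v _ => ?_
  change q ^ inversions (consPerm a v) * g (consPerm a v) = _
  rw [inversions_consPerm, pow_add, mul_assoc]

theorem partitionFunction_succ (n : ℕ) (q : ℝ) :
    partitionFunction (n + 1) q = qInt q (n + 1) * partitionFunction n q := by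
  have := sum_consPerm (n := n) q (fun _ => 1)
  simp only [mul_one] at this
  rw [partitionFunction, this, ← Finset.sum_mul, qInt,
    Finset.sum_range (fun i => q ^ i), partitionFunction]

/-- The mean of a function of the first value, which has a truncated geometric distribution. -/
noncomputable def firstMean (n : ℕ) (q : ℝ) (x : Fin (n + 1) → ℝ) : ℝ :=
  (∑ a : Fin (n + 1), q ^ (a : ℕ) * x a) / qInt q (n + 1)

theorem mallowsMean_succ {n : ℕ} {q : ℝ} (hq : 0 < q) (g : Equiv.Perm (Fin (n + 1)) → ℝ) :
    mallowsMean (n + 1) q g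
      = firstMean n q (fun a => mallowsMean n q (fun v => g (consPerm a v))) := by
  have := (partitionFunction_pos n hq).ne'
  have := (qInt_pos hq n.succ_pos).ne'
  rw [mallowsMean, sum_consPerm, partitionFunction_succ, firstMean]
  simp only [mallowsMean, mul_div_assoc', ← Finset.sum_div]
  rw [div_div, mul_comm]

theorem firstMean_add (n : ℕ) (q : ℝ) (x y : Fin (n + 1) → ℝ) :
    firstMean n q (fun a => x a + y a) = firstMean n q x + firstMean n q y := by
  simp only [firstMean, mul_add, Finset.sum_add_distrib, add_div]

theorem firstMean_const_mul (n : ℕ) (q c : ℝ) (x : Fin (n + 1) → ℝ) :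
    firstMean n q (fun a => c * x a) = c * firstMean n q x := by
  simp only [firstMean, mul_left_comm _ c, ← Finset.mul_sum, mul_div_assoc]

theorem firstMean_const (n : ℕ) {q : ℝ} (hq : 0 < q) (c : ℝ) :
    firstMean n q (fun _ => c) = c := by
  rw [firstMean, ← Finset.sum_mul, ← Finset.sum_range (fun i => q ^ i)]
  exact mul_div_cancel_left₀ c (qInt_pos hq n.succ_pos).ne'

theorem firstMean_mono (n : ℕ) {q : ℝ} (hq : 0 < q) {x y : Fin (n + 1) → ℝ}
    (h : ∀ a, x a ≤ y a) : firstMean n q x ≤ firstMean n q y := by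
  unfold firstMean
  have := qInt_pos hq n.succ_pos
  gcongr with a
  exact h a

theorem firstMean_sq_le {n : ℕ} {q : ℝ} (hq : 0 < q) :
    firstMean n q (fun a => ((a : ℕ) : ℝ) ^ 2) ≤ 2 * qInt q (n + 1) ^ 2 := by
  have h := qInt_pos hq n.succ_pos
  rw [firstMean, div_le_iff₀ h, ← Finset.sum_range (fun i => q ^ i * (i : ℝ) ^ 2)]
  refine (sum_pow_mul_sq_le hq (n + 1)).trans_eq (by ring)

/-! ### Exchanging the values at two adjacent positions -/

/-- The adjacent transposition of the positions `i` and `i + 1`. -/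
def adjSwap {m : ℕ} (i : Fin m) : Equiv.Perm (Fin (m + 1)) :=
  Equiv.swap i.castSucc i.succ

@[simp]
theorem adjSwap_castSucc {m : ℕ} (i : Fin m) : adjSwap i i.castSucc = i.succ :=
  Equiv.swap_apply_left _ _

@[simp]
theorem adjSwap_succ {m : ℕ} (i : Fin m) : adjSwap i i.succ = i.castSucc :=
  Equiv.swap_apply_right _ _

@[simp]
theorem adjSwap_inv {m : ℕ} (i : Fin m) : (adjSwap i)⁻¹ = adjSwap i :=
  Equiv.swap_inv _ _

@[simp]
theorem adjSwap_adjSwap {m : ℕ} (i : Fin m) (a : Fin (m + 1)) :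
    adjSwap i (adjSwap i a) = a :=
  Equiv.swap_apply_self _ _ _

theorem adjSwap_of_ne {m : ℕ} (i : Fin m) {a : Fin (m + 1)} (h1 : (a : ℕ) ≠ i)
    (h2 : (a : ℕ) ≠ i + 1) : adjSwap i a = a :=
  Equiv.swap_apply_of_ne_of_ne (by simpa [Fin.ext_iff] using h1) (by simpa [Fin.ext_iff] using h2)

/-- An adjacent transposition preserves the order of every other pair. -/
theorem adjSwap_lt_adjSwap {m : ℕ} (i : Fin m) {a b : Fin (m + 1)} (hab : a < b)
    (h : ¬(a = i.castSucc ∧ b = i.succ)) : adjSwap i a < adjSwap i b := by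
  unfold adjSwap
  simp only [Equiv.swap_apply_def, Fin.ext_iff, Fin.lt_def, Fin.val_castSucc, Fin.val_succ] at *
  split_ifs <;> first | omega | (simp only [Fin.val_castSucc, Fin.val_succ]; omega)

theorem adjSwap_lt_iff {m : ℕ} (i : Fin m) {a b : Fin (m + 1)}
    (h : ¬(a = i.castSucc ∧ b = i.succ)) (h' : ¬(b = i.castSucc ∧ a = i.succ)) :
    adjSwap i a < adjSwap i b ↔ a < b := by
  rcases lt_trichotomy a b with hab | hab | hab
  · simp [hab, adjSwap_lt_adjSwap i hab h]
  · simp [hab]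
  · simp [hab.not_gt, (adjSwap_lt_adjSwap i hab h').le]

theorem inversions_mul_adjSwap {m : ℕ} (w : Equiv.Perm (Fin (m + 1))) (i : Fin m)
    (h : w i.castSucc < w i.succ) : inversions (w * adjSwap i) = inversions w + 1 := by
  have hmem : (i.castSucc, i.succ) ∈ Finset.univ.filter fun p : Fin (m + 1) × Fin (m + 1) =>
      p.1 < p.2 ∧ (w * adjSwap i) p.2 < (w * adjSwap i) p.1 := by
    rw [Finset.mem_filter]
    simp only [Finset.mem_univ, true_and, Equiv.Perm.coe_mul,
      Function.comp_apply, adjSwap_succ, adjSwap_castSucc]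
    exact ⟨Fin.castSucc_lt_succ, h⟩
  unfold inversions
  rw [← Finset.card_erase_add_one hmem]
  congr 1
  refine Finset.card_nbij' (fun p => (adjSwap i p.1, adjSwap i p.2))
    (fun p => (adjSwap i p.1, adjSwap i p.2)) ?_ ?_ ?_ ?_
  · rintro ⟨a, b⟩ hp
    rw [Finset.mem_coe, Finset.mem_erase, Finset.mem_filter] at hp
    rw [Finset.mem_coe, Finset.mem_filter]
    simp only [Finset.mem_univ, true_and, ne_eq, Prod.mk.injEq, Equiv.Perm.coe_mul,
      Function.comp_apply] at hp ⊢
    exact ⟨adjSwap_lt_adjSwap i hp.2.1 hp.1, hp.2.2⟩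
  · rintro ⟨a, b⟩ hp
    rw [Finset.mem_coe, Finset.mem_filter] at hp
    rw [Finset.mem_coe, Finset.mem_erase, Finset.mem_filter]
    simp only [Finset.mem_univ, true_and, ne_eq, Prod.mk.injEq, Equiv.Perm.coe_mul,
      Function.comp_apply, adjSwap_adjSwap] at hp ⊢
    have hne : ¬(a = i.castSucc ∧ b = i.succ) := by
      rintro ⟨rfl, rfl⟩
      exact lt_asymm h hp.2
    refine ⟨?_, adjSwap_lt_adjSwap i hp.1 hne, hp.2⟩
    rintro ⟨h1, h2⟩
    have h1' : a = i.succ := by rw [← adjSwap_adjSwap i a, h1, adjSwap_castSucc]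
    have h2' : b = i.castSucc := by rw [← adjSwap_adjSwap i b, h2, adjSwap_succ]
    have := hp.1
    rw [h1', h2', Fin.lt_def] at this
    simp at this
  · rintro ⟨a, b⟩ _; simp
  · rintro ⟨a, b⟩ _; simp

/-- Swapping the two values at an ascent multiplies the Mallows weight by `q`. -/
theorem mallowsMean_descent {m : ℕ} {q : ℝ} (i : Fin m)
    (g : Equiv.Perm (Fin (m + 1)) → ℝ) :
    mallowsMean (m + 1) q (fun w => if w i.succ < w i.castSucc then g w else 0)
      = q * mallowsMean (m + 1) q
          (fun w => if w i.castSucc < w i.succ then g (w * adjSwap i) else 0) := by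
  unfold mallowsMean
  rw [← mul_div_assoc, Finset.mul_sum]
  congr 1
  rw [← Equiv.sum_comp (Equiv.mulRight (adjSwap i))]
  refine Finset.sum_congr rfl fun w _ => ?_
  simp only [Equiv.coe_mulRight, Equiv.Perm.coe_mul, Function.comp_apply, adjSwap_succ,
    adjSwap_castSucc]
  split_ifs with h
  · rw [inversions_mul_adjSwap w i h]; ring
  · simp

theorem mallowsMean_descent_add_ascent {m : ℕ} {q : ℝ} (i : Fin m)
    (g : Equiv.Perm (Fin (m + 1)) → ℝ) :
    mallowsMean (m + 1) q (fun w => if w i.succ < w i.castSucc then g w else 0)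
        + mallowsMean (m + 1) q (fun w => if w i.castSucc < w i.succ then g w else 0)
      = mallowsMean (m + 1) q g := by
  rw [← mallowsMean_add]
  congr 1
  ext w
  have : w i.succ ≠ w i.castSucc := fun h => by simpa [Fin.ext_iff] using w.injective h
  rcases lt_or_gt_of_ne this with h | h <;> simp [h, h.le]

theorem mallowsMean_ascent {m : ℕ} {q : ℝ} (hq : 0 < q) (i : Fin m) :
    mallowsMean (m + 1) q (fun w => if w i.castSucc < w i.succ then 1 else 0)
      = (1 + q)⁻¹ := by
  have h1 := mallowsMean_descent (q := q) i (fun _ => 1)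
  have h2 := mallowsMean_descent_add_ascent (q := q) i (fun _ => 1)
  rw [h1, mallowsMean_const _ hq] at h2
  apply eq_inv_of_mul_eq_one_left
  linarith

/-- The size-bias identity for one descent indicator, centred at its mean `q / (1 + q)`. -/
theorem mallowsMean_descent_sub {m : ℕ} {q : ℝ} (hq : 0 < q) (i : Fin m)
    (g : Equiv.Perm (Fin (m + 1)) → ℝ) :
    mallowsMean (m + 1) q (fun w => if w i.succ < w i.castSucc then g w else 0)
        - q / (1 + q) * mallowsMean (m + 1) q g
      = q / (1 + q) * mallowsMean (m + 1) q
          (fun w => if w i.castSucc < w i.succ then g (w * adjSwap i) - g w else 0) := by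
  have h1 := mallowsMean_descent (q := q) i g
  have h2 := mallowsMean_descent_add_ascent (q := q) i g
  have h3 : mallowsMean (m + 1) q
      (fun w => if w i.castSucc < w i.succ then g (w * adjSwap i) - g w else 0)
      = mallowsMean (m + 1) q (fun w => if w i.castSucc < w i.succ then g (w * adjSwap i) else 0)
        - mallowsMean (m + 1) q (fun w => if w i.castSucc < w i.succ then g w else 0) := by
    rw [← mallowsMean_sub]
    congr 1
    ext w
    split_ifs <;> simp
  rw [h3, ← h2]
  have : 1 + q ≠ 0 := by positivity
  field_simp
  linarith

/-! ### The increment of the two-sided descent statistic -/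

theorem des_eq_sum {m : ℕ} (w : Equiv.Perm (Fin (m + 1))) :
    (des w : ℝ) = ∑ i : Fin m, if w i.succ < w i.castSucc then 1 else 0 := by
  rw [des, Finset.sum_boole]
  congr 1
  symm
  refine Finset.card_nbij (fun i => (i.castSucc, i.succ)) ?_ ?_ ?_
  · intro i; simp
  · intro i _ j _ h
    simpa using h
  · rintro ⟨a, b⟩ h
    simp only [Finset.mem_coe, Finset.mem_filter, Finset.mem_univ, true_and] at h
    have hb := b.isLt
    refine ⟨⟨a, by omega⟩, ?_, ?_⟩
    · have h1 : (⟨a, by omega⟩ : Fin m).castSucc = a := rfl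
      have h2 : (⟨a, by omega⟩ : Fin m).succ = b := Fin.ext h.1
      simpa [h1, h2] using h.2
    · exact Prod.ext rfl (Fin.ext h.1)

theorem twoSidedDes_inv {n : ℕ} (w : Equiv.Perm (Fin n)) : twoSidedDes w⁻¹ = twoSidedDes w := by
  simp [twoSidedDes, add_comm]

/-- The change of the two-sided descent statistic when the values at positions `i` and `i + 1` are
sorted into decreasing order. -/
noncomputable def increment {m : ℕ} (i : Fin m) (w : Equiv.Perm (Fin (m + 1))) : ℝ :=
  if w i.castSucc < w i.succ then twoSidedDes (w * adjSwap i) - twoSidedDes w else 0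

/-- The size-bias identity for the two-sided descent statistic. Inversion preserves both the
Mallows distribution and the statistic, so that the descents of the inverse contribute as much as
the descents. -/
theorem mallowsMean_twoSidedDes_sub {m : ℕ} {q : ℝ} (hq : 0 < q) (F : ℝ → ℝ) :
    mallowsMean (m + 1) q (fun w => (twoSidedDes w - 2 * (q / (1 + q)) * m) * F (twoSidedDes w))
      = 2 * (q / (1 + q)) * ∑ i : Fin m, mallowsMean (m + 1) q
          (fun w => if w i.castSucc < w i.succ then
            F (twoSidedDes (w * adjSwap i)) - F (twoSidedDes w) else 0) := by
  have h1 : mallowsMean (m + 1) q (fun w => (des w⁻¹ : ℝ) * F (twoSidedDes w))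
      = mallowsMean (m + 1) q (fun w => (des w : ℝ) * F (twoSidedDes w)) := by
    rw [← mallowsMean_inv (m + 1) q (fun w => (des w : ℝ) * F (twoSidedDes w))]
    simp only [twoSidedDes_inv]
  have h2 : mallowsMean (m + 1) q (fun w => (des w : ℝ) * F (twoSidedDes w))
      = ∑ i : Fin m, mallowsMean (m + 1) q
        (fun w => if w i.succ < w i.castSucc then F (twoSidedDes w) else 0) := by
    rw [← mallowsMean_sum]
    congr 1
    ext w
    rw [des_eq_sum, Finset.sum_mul]
    simp
  have h3 : (fun w : Equiv.Perm (Fin (m + 1)) =>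
      (twoSidedDes w - 2 * (q / (1 + q)) * m) * F (twoSidedDes w))
      = fun w => ((des w : ℝ) * F (twoSidedDes w) + (des w⁻¹ : ℝ) * F (twoSidedDes w))
        - (2 * (q / (1 + q)) * m) * F (twoSidedDes w) := by
    ext w; rw [twoSidedDes]; ring
  rw [h3, mallowsMean_sub, mallowsMean_add, mallowsMean_const_mul, h1, h2, Finset.mul_sum]
  simp only [mul_assoc, ← mallowsMean_descent_sub hq _ (fun w => F (twoSidedDes w))]
  rw [← Finset.mul_sum, Finset.sum_sub_distrib]
  simp only [Finset.sum_const, Finset.card_univ, Fintype.card_fin, nsmul_eq_mul]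
  ring

/-- The sequence `x, y, f 0, f 1, …, f (n - 1)`, continued by the constant `x`. -/
def prefixSeq {n : ℕ} (x y : ℕ) (f : Fin n → ℕ) : ℕ → ℕ
  | 0 => x
  | 1 => y
  | k + 2 => if h : k < n then f ⟨k, h⟩ else x

theorem prefixSeq_val {n : ℕ} (x y : ℕ) (f : Fin n → ℕ) (i : Fin n) :
    prefixSeq x y f (i + 2) = f i := by
  simp [prefixSeq]

/-- Sorting an ascent `i, i + 1` into decreasing order removes one descent for each outer
neighbour whose value lies between the two. -/
theorem des_mul_adjSwap_sub {m : ℕ} (w : Equiv.Perm (Fin (m + 1))) (i : Fin m)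
    (h : w i.castSucc < w i.succ) (S : ℕ → ℕ)
    (hS : S = prefixSeq (m + 1) (m + 1) fun j => (w j : ℕ)) :
    (des (w * adjSwap i) : ℝ) - des w
      = 1 - (if S (i + 2) < S (i + 1) ∧ S (i + 1) < S (i + 3) then 1 else 0)
        - (if S (i + 2) < S (i + 4) ∧ S (i + 4) < S (i + 3) then 1 else 0) := by
  have hSw : ∀ j : Fin (m + 1), S (j + 2) = w j := fun j => by rw [hS, prefixSeq_val]
  have hS1 : S 1 = m + 1 := by rw [hS]; rfl
  have hSm : S (m + 3) = m + 1 := by rw [hS]; simp [prefixSeq]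
  have hlt : ∀ j, j < m + 1 → S (j + 2) < m + 1 := fun j hj => by
    simpa [← hSw] using (w ⟨j, hj⟩).isLt
  have hinj : ∀ j k, j < m + 1 → k < m + 1 → j ≠ k → S (j + 2) ≠ S (k + 2) := by
    intro j k hj hk hjk hw
    rw [show j = ((⟨j, hj⟩ : Fin (m + 1)) : ℕ) from rfl,
      show k = ((⟨k, hk⟩ : Fin (m + 1)) : ℕ) from rfl, hSw, hSw] at hw
    exact hjk (by simpa using w.injective (Fin.ext hw))
  have hcs : ∀ k : Fin m, (w k.castSucc : ℕ) = S (k + 2) := fun k => (hSw k.castSucc).symm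
  have hsc : ∀ k : Fin m, (w k.succ : ℕ) = S (k + 3) := fun k => (hSw k.succ).symm
  have hi : (i : ℕ) < m := i.isLt
  rw [Fin.lt_def, hcs, hsc] at h
  -- The values of the permutation after the swap.
  have hT : ∀ j : Fin (m + 1), ((w * adjSwap i) j : ℕ)
      = if (j : ℕ) = i then S (i + 3) else if (j : ℕ) = i + 1 then S (i + 2) else S (j + 2) := by
    intro j
    simp only [Equiv.Perm.coe_mul, Function.comp_apply]
    split_ifs with h1 h2
    · rw [show j = i.castSucc from Fin.ext h1, adjSwap_castSucc, hsc]
    · rw [show j = i.succ from Fin.ext h2, adjSwap_succ, hcs]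
    · rw [adjSwap_of_ne i h1 h2, hSw]
  rw [des_eq_sum, des_eq_sum, ← Finset.sum_sub_distrib]
  have hk : ∀ k : Fin m,
      ((if (w * adjSwap i) k.succ < (w * adjSwap i) k.castSucc then (1 : ℝ) else 0)
        - if w k.succ < w k.castSucc then 1 else 0)
      = (if k = i then 1 else 0)
        - (if (k : ℕ) + 1 = i then
            if S (i + 2) < S (i + 1) ∧ S (i + 1) < S (i + 3) then 1 else 0 else 0)
        - (if (k : ℕ) = i + 1 then
            if S (i + 2) < S (i + 4) ∧ S (i + 4) < S (i + 3) then 1 else 0 else 0) := by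
    intro k
    have hkm : (k : ℕ) < m := k.isLt
    simp only [Fin.lt_def, hT, hcs, hsc, Fin.val_castSucc, Fin.val_succ, Fin.ext_iff]
    by_cases h1 : (k : ℕ) = i
    · rw [h1]
      simp [h, h.le]
    by_cases h2 : (k : ℕ) + 1 = i
    · have e1 : S ((k : ℕ) + 2) = S (i + 1) := by rw [← h2]
      have e2 : S ((k : ℕ) + 3) = S (i + 2) := by rw [← h2]
      have hne : S (i + 1) ≠ S (i + 3) := by
        rw [← e1]; exact hinj k (i + 1) (by omega) (by omega) (by omega)
      have hk3 : ¬((k : ℕ) = i + 1) := by omega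
      simp only [h1, h2, hk3, if_true, if_false, e1, e2]
      split_ifs <;> first | omega | norm_num
    by_cases h3 : (k : ℕ) = i + 1
    · have e1 : S ((k : ℕ) + 2) = S (i + 3) := by rw [h3]
      have e2 : S ((k : ℕ) + 3) = S (i + 4) := by rw [h3]
      have hne : S (i + 4) ≠ S (i + 2) := by
        rw [← e2]; exact hinj (k + 1) i (by omega) (by omega) (by omega)
      have h4 : ¬((i : ℕ) + 1 + 1 = i) := by omega
      have h5 : ¬((i : ℕ) + 1 = i) := by omega
      have h6 : ¬((i : ℕ) + 1 + 1 = i + 1) := by omega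
      rw [e1, e2, h3]
      simp only [h4, h5, h6, if_false, if_true]
      split_ifs <;> first | omega | norm_num
    · have hk4 : ¬((k : ℕ) + 1 = i + 1) := by omega
      simp [h1, h2, h3]
  rw [Finset.sum_congr rfl fun k _ => hk k, Finset.sum_sub_distrib, Finset.sum_sub_distrib]
  congr 1
  · congr 1
    · simp
    · rcases Nat.eq_zero_or_pos (i : ℕ) with h0 | h0
      · rw [if_neg, Finset.sum_eq_zero]
        · intro k _
          rw [if_neg (by omega)]
        · rw [h0, zero_add, zero_add, hS1, zero_add]
          have := hlt 1 (by omega)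
          simp only [Nat.reduceAdd] at this
          omega
      · rw [Finset.sum_eq_single (⟨i - 1, by omega⟩ : Fin m)]
        · rw [if_pos (by simp only; omega)]
        · intro k _ hne
          rw [if_neg]
          intro hk'
          exact hne (Fin.ext (by simp only; omega))
        · simp
  · by_cases h0 : (i : ℕ) + 1 = m
    · rw [if_neg, Finset.sum_eq_zero]
      · intro k _
        rw [if_neg (by omega)]
      · have : S (i + 3) < m + 1 := hlt (i + 1) (by omega)
        rw [show (i : ℕ) + 4 = m + 3 by omega, hSm]
        omega
    · rw [Finset.sum_eq_single (⟨i + 1, by omega⟩ : Fin m)]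
      · rw [if_pos rfl]
      · intro k _ hne
        rw [if_neg]
        intro hk'
        exact hne (Fin.ext hk')
      · simp

/-- Sorting an ascent `i, i + 1` into decreasing order creates a descent of the inverse exactly
when the two values are consecutive integers. -/
theorem des_inv_mul_adjSwap_sub {m : ℕ} (w : Equiv.Perm (Fin (m + 1))) (i : Fin m)
    (h : w i.castSucc < w i.succ) :
    (des (w * adjSwap i)⁻¹ : ℝ) - des w⁻¹
      = if (w i.succ : ℕ) = w i.castSucc + 1 then 1 else 0 := by
  rw [des_eq_sum, des_eq_sum, ← Finset.sum_sub_distrib]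
  have hk : ∀ k : Fin m,
      ((if (w * adjSwap i)⁻¹ k.succ < (w * adjSwap i)⁻¹ k.castSucc then (1 : ℝ) else 0)
        - if w⁻¹ k.succ < w⁻¹ k.castSucc then 1 else 0)
      = if w i.castSucc = k.castSucc ∧ w i.succ = k.succ then 1 else 0 := by
    intro k
    simp only [mul_inv_rev, adjSwap_inv, Equiv.Perm.coe_mul, Function.comp_apply]
    have hne : ¬(w⁻¹ k.succ = i.castSucc ∧ w⁻¹ k.castSucc = i.succ) := by
      rintro ⟨h1, h2⟩
      rw [Equiv.Perm.inv_eq_iff_eq] at h1 h2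
      rw [← h1, ← h2, Fin.lt_def] at h
      simp at h
    by_cases hc : w⁻¹ k.castSucc = i.castSucc ∧ w⁻¹ k.succ = i.succ
    · have hc' : w i.castSucc = k.castSucc ∧ w i.succ = k.succ :=
        ⟨(Equiv.Perm.inv_eq_iff_eq.1 hc.1).symm, (Equiv.Perm.inv_eq_iff_eq.1 hc.2).symm⟩
      rw [if_pos hc', hc.1, hc.2, adjSwap_castSucc, adjSwap_succ]
      simp [Fin.le_def]
    · have hc' : ¬(w i.castSucc = k.castSucc ∧ w i.succ = k.succ) := fun h' =>
        hc ⟨Equiv.Perm.inv_eq_iff_eq.2 h'.1.symm, Equiv.Perm.inv_eq_iff_eq.2 h'.2.symm⟩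
      rw [if_neg hc']
      simp only [adjSwap_lt_iff i hne (fun h' => hc h'), sub_self]
  rw [Finset.sum_congr rfl fun k _ => hk k, Finset.sum_boole]
  split_ifs with hw
  · rw [Nat.cast_eq_one, Finset.card_eq_one]
    have hlt := (w i.succ).isLt
    refine ⟨⟨w i.castSucc, by omega⟩, ?_⟩
    ext k
    simp only [Finset.mem_filter, Finset.mem_univ, true_and, Fin.ext_iff, Fin.val_castSucc,
      Fin.val_succ, Finset.mem_singleton]
    omega
  · rw [Nat.cast_eq_zero, Finset.card_eq_zero, Finset.filter_eq_empty_iff]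
    rintro k - ⟨h1, h2⟩
    exact hw (by rw [h1, h2]; simp)

theorem increment_eq {m : ℕ} (w : Equiv.Perm (Fin (m + 1))) (i : Fin m) (S : ℕ → ℕ)
    (hS : S = prefixSeq (m + 1) (m + 1) fun j => (w j : ℕ)) :
    increment i w
      = (if S (i + 2) < S (i + 3) then 1 else 0) + (if S (i + 3) = S (i + 2) + 1 then 1 else 0)
        - (if S (i + 2) < S (i + 1) ∧ S (i + 1) < S (i + 3) then 1 else 0)
        - (if S (i + 2) < S (i + 4) ∧ S (i + 4) < S (i + 3) then 1 else 0) := by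
  have hcs : (w i.castSucc : ℕ) = S (i + 2) := by
    rw [hS]; exact (prefixSeq_val _ _ (fun j => (w j : ℕ)) i.castSucc).symm
  have hsc : (w i.succ : ℕ) = S (i + 3) := by
    rw [hS]; exact (prefixSeq_val _ _ (fun j => (w j : ℕ)) i.succ).symm
  by_cases h : w i.castSucc < w i.succ
  · have h1 := des_mul_adjSwap_sub w i h S hS
    have h2 := des_inv_mul_adjSwap_sub w i h
    rw [hcs, hsc] at h2
    rw [increment, if_pos h, twoSidedDes, twoSidedDes]
    rw [Fin.lt_def, hcs, hsc] at h
    rw [if_pos h]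
    linarith
  · rw [increment, if_neg h]
    rw [Fin.lt_def, hcs, hsc] at h
    rw [if_neg h, if_neg (by omega), if_neg (by omega), if_neg (by omega)]
    norm_num

theorem increment_sq_le {m : ℕ} (w : Equiv.Perm (Fin (m + 1))) (i : Fin m) :
    increment i w ^ 2 ≤ 4 * if w i.castSucc < w i.succ then 1 else 0 := by
  by_cases h : w i.castSucc < w i.succ
  · rw [increment_eq w i _ rfl, if_pos h]
    generalize (prefixSeq (m + 1) (m + 1) fun j => (w j : ℕ)) = S
    split_ifs <;> first | omega | norm_num
  · rw [increment, if_neg h, if_neg h]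
    norm_num

/-- The score of three consecutive entries: it counts an ascent and a succession in the last two
entries, and penalizes the patterns `213` and `132`. -/
noncomputable def tripleScore (x y z : ℕ) : ℝ :=
  (if y < z then 1 else 0) + (if z = y + 1 then 1 else 0)
    - (if y < x ∧ x < z then 1 else 0) - (if x < z ∧ z < y then 1 else 0)

/-- The sum of the scores of the first `n` triples of consecutive entries of a sequence. -/
noncomputable def totalScore (n : ℕ) (S : ℕ → ℕ) : ℝ :=
  ∑ j ∈ Finset.range n, tripleScore (S j) (S (j + 1)) (S (j + 2))

/-- The increments sum to a statistic of triples of consecutive values. The two large entries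
in front of the values take no part in any of the counted patterns. -/
theorem sum_increment {m : ℕ} (w : Equiv.Perm (Fin (m + 1))) :
    ∑ i, increment i w
      = totalScore (m + 1) (prefixSeq (m + 1) (m + 1) fun j => (w j : ℕ)) := by
  set S := prefixSeq (m + 1) (m + 1) fun j => (w j : ℕ) with hS
  have hS0 : S 0 = m + 1 := rfl
  have hS1 : S 1 = m + 1 := rfl
  have hSm : S (m + 3) = m + 1 := by rw [hS]; simp [prefixSeq]
  have hlt : ∀ j, j < m + 1 → S (j + 2) < m + 1 := fun j hj => by
    rw [hS, show j = ((⟨j, hj⟩ : Fin (m + 1)) : ℕ) from rfl, prefixSeq_val]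
    exact (w _).isLt
  set a : ℕ → ℝ := fun j => (if S (j + 1) < S (j + 2) then 1 else 0)
    + (if S (j + 2) = S (j + 1) + 1 then 1 else 0)
    - (if S (j + 1) < S j ∧ S j < S (j + 2) then 1 else 0) with ha
  set b : ℕ → ℝ := fun j => if S j < S (j + 2) ∧ S (j + 2) < S (j + 1) then 1 else 0 with hb
  have h1 : ∑ i, increment i w = ∑ i ∈ Finset.range m, (a (i + 1) - b (i + 2)) := by
    rw [Finset.sum_range]
    exact Finset.sum_congr rfl fun i _ => increment_eq w i S hS
  have h2 : totalScore (m + 1) S = ∑ j ∈ Finset.range (m + 1), (a j - b j) := rfl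
  have ha0 : a 0 = 0 := by
    have : S 2 < m + 1 := hlt 0 (by omega)
    simp only [ha, zero_add]
    rw [if_neg (by omega), if_neg (by omega), if_neg (by omega)]
    norm_num
  have hb0 : b 0 = 0 := by
    have : S 2 < m + 1 := hlt 0 (by omega)
    simp only [hb, zero_add]
    rw [if_neg (by omega)]
  have hblast : b (m + 1) = 0 := by
    have := hlt m (by omega)
    simp only [hb]
    rw [if_neg (by rw [show m + 1 + 2 = m + 3 from rfl, show m + 1 + 1 = m + 2 from rfl]; omega)]
  have hb1 : b 1 = 0 := by
    simp only [hb]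
    rcases Nat.eq_zero_or_pos m with rfl | hm
    · rw [if_neg (by simp only [hS1, hSm, Nat.reduceAdd] at *; omega)]
    · have : S 3 < m + 1 := hlt 1 (by omega)
      rw [if_neg (by simp only [Nat.reduceAdd]; omega)]
  rw [h1, h2, Finset.sum_sub_distrib (f := fun i => a (i + 1)), Finset.sum_sub_distrib (f := a),
    Finset.sum_range_succ' a, ha0]
  have h3 : ∑ j ∈ Finset.range (m + 1), b j = ∑ j ∈ Finset.range m, b (j + 2) := by
    have := Finset.sum_range_succ b (m + 1)
    rw [Finset.sum_range_succ' b (m + 1), Finset.sum_range_succ' (fun j => b (j + 1)) m, hblast,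
      hb0, zero_add, hb1] at this
    linarith
  rw [h3]
  ring

/-! ### The mean increment -/

theorem mallowsMean_event_swap {m : ℕ} {q : ℝ} (i : Fin m)
    (R R' : Equiv.Perm (Fin (m + 1)) → Prop) [DecidablePred R] [DecidablePred R']
    (h1 : ∀ w, R w → w i.succ < w i.castSucc)
    (h2 : ∀ w, R' w ↔ w i.castSucc < w i.succ ∧ R (w * adjSwap i)) :
    mallowsMean (m + 1) q (fun w => if R w then 1 else 0)
      = q * mallowsMean (m + 1) q (fun w => if R' w then 1 else 0) := by
  have h := mallowsMean_descent (q := q) i (fun w => if R w then 1 else 0)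
  convert h using 2
  · ext w
    by_cases hR : R w
    · simp [hR, h1 w hR]
    · simp [hR]
  · congr 1
    ext w
    by_cases hR : R' w
    · simp [hR, ((h2 w).1 hR).1, ((h2 w).1 hR).2]
    · rw [if_neg hR]
      split_ifs with h3 h4
      · exact absurd ((h2 w).2 ⟨h3, h4⟩) hR
      · rfl
      · rfl

/-- Among three consecutive positions the pattern `213` has probability at most one third of that
of an ascent at the last two: the patterns `123`, `213`, `312` have probabilities in the ratio
`1 : q : q ^ 2`. -/
theorem mallowsMean_pattern_left_le {m : ℕ} {q : ℝ} (hq : 0 < q) (i k : Fin m)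
    (hik : i.succ = k.castSucc) :
    mallowsMean (m + 1) q
        (fun w => if w k.castSucc < w i.castSucc ∧ w i.castSucc < w k.succ then 1 else 0)
      ≤ (1 + q)⁻¹ / 3 := by
  have hv : (i : ℕ) + 1 = k := by simpa [Fin.ext_iff] using hik
  have iA : adjSwap i i.castSucc = k.castSucc := by rw [adjSwap_castSucc, hik]
  have iB : adjSwap i k.castSucc = i.castSucc := by rw [← hik, adjSwap_succ]
  have iC : adjSwap i k.succ = k.succ :=
    adjSwap_of_ne i (by simp only [Fin.val_succ]; omega) (by simp only [Fin.val_succ]; omega)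
  have kA : adjSwap k i.castSucc = i.castSucc :=
    adjSwap_of_ne k (by simp only [Fin.val_castSucc]; omega)
      (by simp only [Fin.val_castSucc]; omega)
  have hAC : i.castSucc ≠ k.succ := by
    simp only [ne_eq, Fin.ext_iff, Fin.val_castSucc, Fin.val_succ]; omega
  have hAB : i.castSucc ≠ k.castSucc := by
    simp only [ne_eq, Fin.ext_iff, Fin.val_castSucc]; omega
  have e1 := mallowsMean_event_swap (q := q) i
    (fun w => w k.castSucc < w i.castSucc ∧ w i.castSucc < w k.succ)
    (fun w => w i.castSucc < w k.castSucc ∧ w k.castSucc < w k.succ)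
    (fun w h => by rw [hik]; exact h.1)
    (fun w => by simp [hik, iA, iB, iC])
  have e2 := mallowsMean_event_swap (q := q) i
    (fun w => w k.castSucc < w k.succ ∧ w k.succ < w i.castSucc)
    (fun w => w i.castSucc < w k.succ ∧ w k.succ < w k.castSucc)
    (fun w h => by rw [hik]; exact h.1.trans h.2)
    (fun w => by
      simp only [hik, iA, iB, iC, Equiv.Perm.coe_mul, Function.comp_apply]
      exact ⟨fun h => ⟨h.1.trans h.2, h⟩, fun h => h.2⟩)
  have e3 := mallowsMean_event_swap (q := q) k
    (fun w => w i.castSucc < w k.succ ∧ w k.succ < w k.castSucc)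
    (fun w => w i.castSucc < w k.castSucc ∧ w k.castSucc < w k.succ)
    (fun w h => h.2)
    (fun w => by simp [kA])
  have e4 := mallowsMean_ascent hq k
  have e5 : (fun w : Equiv.Perm (Fin (m + 1)) => if w k.castSucc < w k.succ then (1 : ℝ) else 0)
      = fun w => ((if w i.castSucc < w k.castSucc ∧ w k.castSucc < w k.succ then (1 : ℝ) else 0)
        + (if w k.castSucc < w i.castSucc ∧ w i.castSucc < w k.succ then 1 else 0))
        + (if w k.castSucc < w k.succ ∧ w k.succ < w i.castSucc then 1 else 0) := by
    ext w
    have h1 : w i.castSucc ≠ w k.succ := fun h => hAC (w.injective h)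
    have h2 : w i.castSucc ≠ w k.castSucc := fun h => hAB (w.injective h)
    simp only [ne_eq, Fin.ext_iff, Fin.lt_def] at h1 h2 ⊢
    split_ifs <;> first | omega | norm_num
  rw [e5, mallowsMean_add, mallowsMean_add, e2, e3, e1] at e4
  rw [e1, ← e4]
  have h0 := mallowsMean_nonneg (m + 1) hq (g := fun w =>
    if w i.castSucc < w k.castSucc ∧ w k.castSucc < w k.succ then (1 : ℝ) else 0)
    (fun w => by positivity)
  nlinarith [mul_nonneg h0 (sq_nonneg (1 - q))]

/-- Among three consecutive positions the pattern `132` has probability at most one third of that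
of an ascent at the first two: the patterns `123`, `132`, `231` have probabilities in the ratio
`1 : q : q ^ 2`. -/
theorem mallowsMean_pattern_right_le {m : ℕ} {q : ℝ} (hq : 0 < q) (i k : Fin m)
    (hik : i.succ = k.castSucc) :
    mallowsMean (m + 1) q
        (fun w => if w i.castSucc < w k.succ ∧ w k.succ < w i.succ then 1 else 0)
      ≤ (1 + q)⁻¹ / 3 := by
  have hv : (i : ℕ) + 1 = k := by simpa [Fin.ext_iff] using hik
  have kB : adjSwap k i.succ = k.succ := by rw [hik, adjSwap_castSucc]
  have kC : adjSwap k k.succ = i.succ := by rw [hik, adjSwap_succ]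
  have kA : adjSwap k i.castSucc = i.castSucc :=
    adjSwap_of_ne k (by simp only [Fin.val_castSucc]; omega)
      (by simp only [Fin.val_castSucc]; omega)
  have iC : adjSwap i k.succ = k.succ :=
    adjSwap_of_ne i (by simp only [Fin.val_succ]; omega) (by simp only [Fin.val_succ]; omega)
  have hAC : i.castSucc ≠ k.succ := by
    simp only [ne_eq, Fin.ext_iff, Fin.val_castSucc, Fin.val_succ]; omega
  have hBC : i.succ ≠ k.succ := by
    simp only [ne_eq, Fin.ext_iff, Fin.val_succ]; omega
  have e1 := mallowsMean_event_swap (q := q) k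
    (fun w => w i.castSucc < w k.succ ∧ w k.succ < w i.succ)
    (fun w => w i.castSucc < w i.succ ∧ w i.succ < w k.succ)
    (fun w h => by rw [← hik]; exact h.2)
    (fun w => by simp [← hik, kA, kB, kC])
  have e2 := mallowsMean_event_swap (q := q) k
    (fun w => w k.succ < w i.castSucc ∧ w i.castSucc < w i.succ)
    (fun w => w i.succ < w i.castSucc ∧ w i.castSucc < w k.succ)
    (fun w h => by rw [← hik]; exact h.1.trans h.2)
    (fun w => by
      simp only [← hik, kA, kB, kC, Equiv.Perm.coe_mul, Function.comp_apply]
      exact ⟨fun h => ⟨h.1.trans h.2, h⟩, fun h => h.2⟩)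
  have e3 := mallowsMean_event_swap (q := q) i
    (fun w => w i.succ < w i.castSucc ∧ w i.castSucc < w k.succ)
    (fun w => w i.castSucc < w i.succ ∧ w i.succ < w k.succ)
    (fun w h => h.1)
    (fun w => by simp [iC])
  have e4 := mallowsMean_ascent hq i
  have e5 : (fun w : Equiv.Perm (Fin (m + 1)) => if w i.castSucc < w i.succ then (1 : ℝ) else 0)
      = fun w => ((if w i.castSucc < w i.succ ∧ w i.succ < w k.succ then (1 : ℝ) else 0)
        + (if w i.castSucc < w k.succ ∧ w k.succ < w i.succ then 1 else 0))
        + (if w k.succ < w i.castSucc ∧ w i.castSucc < w i.succ then 1 else 0) := by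
    ext w
    have h1 : w i.castSucc ≠ w k.succ := fun h => hAC (w.injective h)
    have h2 : w i.succ ≠ w k.succ := fun h => hBC (w.injective h)
    simp only [ne_eq, Fin.ext_iff, Fin.lt_def] at h1 h2 ⊢
    split_ifs <;> first | omega | norm_num
  rw [e5, mallowsMean_add, mallowsMean_add, e2, e3, e1] at e4
  rw [e1, ← e4]
  have h0 := mallowsMean_nonneg (m + 1) hq (g := fun w =>
    if w i.castSucc < w i.succ ∧ w i.succ < w k.succ then (1 : ℝ) else 0)
    (fun w => by positivity)
  nlinarith [mul_nonneg h0 (sq_nonneg (1 - q))]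

theorem le_mallowsMean_increment {m : ℕ} {q : ℝ} (hq : 0 < q) (i : Fin m) :
    (1 + q)⁻¹ / 3 ≤ mallowsMean (m + 1) q (increment i) := by
  set S : Equiv.Perm (Fin (m + 1)) → ℕ → ℕ :=
    fun w => prefixSeq (m + 1) (m + 1) fun j => (w j : ℕ) with hS
  have hval : ∀ w (j : Fin (m + 1)), S w (j + 2) = w j := fun w j => prefixSeq_val _ _ _ j
  have hcs : ∀ w (k : Fin m), S w (k + 2) = w k.castSucc := fun w k => hval w k.castSucc
  have hsc : ∀ w (k : Fin m), S w (k + 3) = w k.succ := fun w k => hval w k.succ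
  have hinv : 0 < (1 + q)⁻¹ / 3 := by positivity
  have h1 : mallowsMean (m + 1) q (fun w =>
      if S w (i + 2) < S w (i + 1) ∧ S w (i + 1) < S w (i + 3) then 1 else 0)
      ≤ (1 + q)⁻¹ / 3 := by
    rcases Nat.eq_zero_or_pos (i : ℕ) with h0 | h0
    · refine le_of_eq_of_le (Eq.trans ?_ (mallowsMean_const (m + 1) hq 0)) hinv.le
      congr 1
      ext w
      have h3 : S w (i + 1) = m + 1 := by rw [h0]; rfl
      have h4 := hsc w i
      have h5 := (w i.succ).isLt
      rw [if_neg (by omega)]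
    · let k : Fin m := ⟨i - 1, by omega⟩
      have hk : (k : ℕ) + 1 = i := by simp only [k]; omega
      have := mallowsMean_pattern_left_le hq k i
        (Fin.ext (by simp only [Fin.val_succ, Fin.val_castSucc, hk]))
      convert this using 3 with w
      rw [show (i : ℕ) + 1 = k + 2 by omega, hcs, hsc, hcs]
      simp only [Fin.lt_def]
  have h2 : mallowsMean (m + 1) q (fun w =>
      if S w (i + 2) < S w (i + 4) ∧ S w (i + 4) < S w (i + 3) then 1 else 0)
      ≤ (1 + q)⁻¹ / 3 := by
    by_cases h0 : (i : ℕ) + 1 = m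
    · refine le_of_eq_of_le (Eq.trans ?_ (mallowsMean_const (m + 1) hq 0)) hinv.le
      congr 1
      ext w
      have h3 : S w (i + 4) = m + 1 := by
        rw [show (i : ℕ) + 4 = m + 3 by omega]; simp [hS, prefixSeq]
      have h4 := hsc w i
      have h5 := (w i.succ).isLt
      rw [if_neg (by omega)]
    · let k : Fin m := ⟨i + 1, by omega⟩
      have hk : (i : ℕ) + 1 = k := rfl
      have := mallowsMean_pattern_right_le hq i k
        (Fin.ext (by simp only [Fin.val_succ, Fin.val_castSucc, hk]))
      convert this using 3 with w
      rw [show (i : ℕ) + 4 = k + 3 by omega, hcs, hsc, hsc]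
      simp only [Fin.lt_def]
  have h3 : mallowsMean (m + 1) q (fun w => ((if w i.castSucc < w i.succ then (1 : ℝ) else 0)
        - (if S w (i + 2) < S w (i + 1) ∧ S w (i + 1) < S w (i + 3) then 1 else 0))
        - (if S w (i + 2) < S w (i + 4) ∧ S w (i + 4) < S w (i + 3) then 1 else 0))
      ≤ mallowsMean (m + 1) q (increment i) := by
    refine mallowsMean_mono _ hq fun w => ?_
    rw [increment_eq w i (S w) rfl, hcs, hsc]
    simp only [Fin.lt_def]
    have : (0 : ℝ) ≤ if (w i.succ : ℕ) = w i.castSucc + 1 then 1 else 0 := by positivity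
    linarith
  rw [mallowsMean_sub, mallowsMean_sub, mallowsMean_ascent hq] at h3
  linarith

/-! ### Variance bounds by conditioning on the first value -/

/-- The variance of `g` under the Mallows distribution with parameter `q`. -/
noncomputable def mallowsVar (n : ℕ) (q : ℝ) (g : Equiv.Perm (Fin n) → ℝ) : ℝ :=
  mallowsMean n q (fun w => (g w - mallowsMean n q g) ^ 2)

theorem mallowsMean_sub_sq (n : ℕ) {q : ℝ} (hq : 0 < q) (g : Equiv.Perm (Fin n) → ℝ) (c : ℝ) :
    mallowsMean n q (fun w => (g w - c) ^ 2) = mallowsVar n q g + (mallowsMean n q g - c) ^ 2 := by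
  set M := mallowsMean n q g with hM
  have h : (fun w => (g w - c) ^ 2)
      = fun w => ((g w - M) ^ 2 + 2 * (M - c) * (g w - M)) + (M - c) ^ 2 := by
    ext w; ring
  rw [h, mallowsMean_add, mallowsMean_add, mallowsMean_const_mul, mallowsMean_sub,
    mallowsMean_const n hq, mallowsMean_const n hq, ← hM, mallowsVar, ← hM]
  ring

theorem mallowsVar_succ_le {n : ℕ} {q : ℝ} (hq : 0 < q) (g : Equiv.Perm (Fin (n + 1)) → ℝ)
    (c : ℝ) :
    mallowsVar (n + 1) q g
      ≤ firstMean n q (fun a => mallowsVar n q (fun v => g (consPerm a v)))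
        + firstMean n q (fun a => (mallowsMean n q (fun v => g (consPerm a v)) - c) ^ 2) := by
  have h1 := mallowsMean_sub_sq (n + 1) hq g c
  rw [mallowsMean_succ hq] at h1
  simp only [mallowsMean_sub_sq n hq] at h1
  rw [firstMean_add] at h1
  nlinarith [sq_nonneg (mallowsMean (n + 1) q g - c)]

/-- If conditioning on successive first values keeps a statistic in a class of statistics whose
conditional means have second moment at most `C` about some constant, then its variance grows at
most linearly. -/
theorem mallowsVar_le_of_consPerm {q : ℝ} (hq : 0 < q) {C : ℝ}
    (p : ∀ n, (Equiv.Perm (Fin n) → ℝ) → Prop)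
    (hcons : ∀ n g, p (n + 1) g → ∀ a, p n (fun v => g (consPerm a v)))
    (hC : ∀ n g, p (n + 2) g → ∃ c,
      firstMean (n + 1) q (fun a => (mallowsMean (n + 1) q (fun v => g (consPerm a v)) - c) ^ 2)
        ≤ C)
    (m : ℕ) (g : Equiv.Perm (Fin (m + 1)) → ℝ) (hg : p (m + 1) g) :
    mallowsVar (m + 1) q g ≤ C * m := by
  induction m with
  | zero =>
    have h : ∀ w, g w = g 1 := fun w => by
      rw [show w = 1 from Equiv.ext fun i => Subsingleton.elim (α := Fin 1) _ _]
    have h2 : g = fun _ => g 1 := funext h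
    rw [mallowsVar, h2]
    simp [mallowsMean_const _ hq]
  | succ m ih =>
    obtain ⟨c, hc⟩ := hC m g hg
    refine (mallowsVar_succ_le hq g c).trans ?_
    have h1 := firstMean_mono (m + 1) hq (fun a => ih _ (hcons _ g hg a))
    rw [firstMean_const _ hq] at h1
    push_cast
    linarith

/-! ### Successions -/

theorem mallowsMean_first_eq_le {k : ℕ} {q : ℝ} (hq : 0 < q) (hq1 : q ≤ 1) (a : ℕ) :
    mallowsMean (k + 1) q (fun v => if (v 0 : ℕ) = a then 1 else 0) ≤ (qInt q (k + 1))⁻¹ := by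
  rw [mallowsMean_succ hq]
  simp only [consPerm_zero, mallowsMean_const _ hq]
  rw [firstMean, div_eq_mul_inv]
  refine mul_le_of_le_one_left (inv_nonneg.2 (qInt_nonneg hq _)) ?_
  by_cases ha : a < k + 1
  · rw [Finset.sum_eq_single (⟨a, ha⟩ : Fin (k + 1))]
    · simpa using pow_le_one₀ hq.le hq1
    · intro b _ hb
      rw [if_neg (fun h => hb (Fin.ext h)), mul_zero]
    · simp
  · rw [Finset.sum_eq_zero]
    · exact zero_le_one
    · intro b _
      rw [if_neg (by omega), mul_zero]

theorem mallowsMean_succession_le_left {k : ℕ} {q : ℝ} (hq : 0 < q) (hq1 : q ≤ 1) (l : Fin k) :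
    mallowsMean (k + 1) q (fun v => if (v l.succ : ℕ) = v l.castSucc + 1 then 1 else 0)
      ≤ (qInt q (k - l))⁻¹ := by
  induction k with
  | zero => exact l.elim0
  | succ k ih =>
    rw [mallowsMean_succ hq, ← firstMean_const (k + 1) hq (qInt q (k + 1 - l))⁻¹]
    refine firstMean_mono _ hq fun a => ?_
    refine Fin.cases ?_ (fun l => ?_) l
    · refine le_trans (mallowsMean_mono _ hq fun v => ?_) (mallowsMean_first_eq_le hq hq1 (a : ℕ))
      simp only [Fin.castSucc_zero, consPerm_zero, consPerm_succ]
      rcases lt_or_ge (v 0).castSucc a with h | h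
      · rw [Fin.succAbove_of_castSucc_lt _ _ h]
        rw [Fin.lt_def] at h
        rw [if_neg (by simp only [Fin.val_castSucc] at *; omega)]
        positivity
      · rw [Fin.succAbove_of_le_castSucc _ _ h, Fin.val_succ]
        simp
    · have h1 := ih l
      rw [show k + 1 - ((l.succ : Fin (k + 1)) : ℕ) = k - l by simp]
      refine le_trans (mallowsMean_mono _ hq fun v => ?_) h1
      rw [Fin.castSucc_succ, consPerm_succ, consPerm_succ]
      by_cases h : (v l.succ : ℕ) = v l.castSucc + 1
      · rw [if_pos h]; split_ifs <;> norm_num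
      · rw [if_neg h, if_neg]
        intro h2
        have hlt : v l.castSucc < v l.succ := by
          have h3 : a.succAbove (v l.castSucc) < a.succAbove (v l.succ) := by
            rw [Fin.lt_def]; omega
          simpa using h3
        have h4 : (v l.castSucc : ℕ) + 1 < v l.succ := by
          rw [Fin.lt_def] at hlt; omega
        simp only [Fin.succAbove, Fin.lt_def, Fin.val_castSucc] at h2
        split_ifs at h2 <;> simp only [Fin.val_castSucc, Fin.val_succ] at h2 <;> omega

/-- Two prescribed consecutive positions carry consecutive increasing values with probability
at most twice the reciprocal of the `q`-integer of the size. -/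
theorem mallowsMean_succession_le {k : ℕ} {q : ℝ} (hq : 0 < q) (hq1 : q ≤ 1) (l : Fin k) :
    mallowsMean (k + 1) q (fun v => if (v l.succ : ℕ) = v l.castSucc + 1 then 1 else 0)
      ≤ 2 / qInt q (k + 1) := by
  have h1 := mallowsMean_succession_le_left hq hq1 l
  have h2 := mallowsMean_succession_le_left hq hq1 l.rev
  have h3 : mallowsMean (k + 1) q
      (fun v => if (v l.rev.succ : ℕ) = v l.rev.castSucc + 1 then 1 else 0)
      = mallowsMean (k + 1) q (fun v => if (v l.succ : ℕ) = v l.castSucc + 1 then 1 else 0) := by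
    rw [← mallowsMean_rev_conj]
    congr 1
    ext v
    have e1 : Fin.rev l.rev.succ = l.castSucc := by rw [Fin.rev_succ, Fin.rev_rev]
    have e2 : Fin.rev l.rev.castSucc = l.succ := by rw [Fin.rev_castSucc, Fin.rev_rev]
    simp only [Equiv.Perm.coe_mul, Function.comp_apply, Fin.revPerm_apply, e1, e2, Fin.val_rev]
    have := (v l.castSucc).isLt
    have := (v l.succ).isLt
    congr 1
    rw [eq_iff_iff]
    omega
  rw [h3, Fin.val_rev, show k - (k - ((l : ℕ) + 1)) = l + 1 by omega] at h2
  have hl := l.isLt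
  have p1 : 0 < qInt q (k - l) := qInt_pos hq (by omega)
  have p2 : 0 < qInt q (l + 1) := qInt_pos hq (by omega)
  have p3 : 0 < qInt q (k + 1) := qInt_pos hq (by omega)
  have h4 := qInt_add_le hq hq1 (k - l) (l + 1)
  rw [show k - l + (l + 1) = k + 1 by omega] at h4
  rw [inv_eq_one_div] at h1 h2
  rcases le_total (qInt q (k - l)) (qInt q (l + 1)) with h | h
  · refine h2.trans ?_
    rw [div_le_div_iff₀ p2 p3]
    linarith
  · refine h1.trans ?_
    rw [div_le_div_iff₀ p1 p3]
    linarith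

theorem sum_succession_eq {k : ℕ} (v : Equiv.Perm (Fin (k + 1))) (a : ℕ) :
    ∑ i : Fin k, (if (v i.succ : ℕ) = v i.castSucc + 1 ∧ (v i.castSucc : ℕ) < a
        then (1 : ℝ) else 0)
      = ∑ l : Fin k, if (l : ℕ) < a then
          (if (v⁻¹ l.succ : ℕ) = v⁻¹ l.castSucc + 1 then 1 else 0) else 0 := by
  have h1 : ∀ i : Fin k, (if (v i.succ : ℕ) = v i.castSucc + 1 ∧ (v i.castSucc : ℕ) < a
        then (1 : ℝ) else 0)
      = ∑ l : Fin k, if v i.castSucc = l.castSucc ∧ v i.succ = l.succ ∧ (l : ℕ) < a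
          then 1 else 0 := by
    intro i
    split_ifs with h
    · have := (v i.succ).isLt
      rw [Finset.sum_eq_single (⟨v i.castSucc, by omega⟩ : Fin k)]
      · rw [if_pos]
        exact ⟨rfl, Fin.ext h.1, h.2⟩
      · intro l _ hl
        rw [if_neg]
        intro h'
        exact hl (Fin.ext (by simp [h'.1]))
      · simp
    · symm
      refine Finset.sum_eq_zero fun l _ => if_neg ?_
      rintro ⟨h1, h2, h3⟩
      refine h ⟨by rw [h1, h2]; simp, by rw [h1]; simpa using h3⟩
  have h2 : ∀ l : Fin k, (if (l : ℕ) < a then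
          (if (v⁻¹ l.succ : ℕ) = v⁻¹ l.castSucc + 1 then (1 : ℝ) else 0) else 0)
      = ∑ i : Fin k, if v i.castSucc = l.castSucc ∧ v i.succ = l.succ ∧ (l : ℕ) < a
          then 1 else 0 := by
    intro l
    rw [← ite_and]
    split_ifs with h
    · have := (v⁻¹ l.succ).isLt
      rw [Finset.sum_eq_single (⟨v⁻¹ l.castSucc, by omega⟩ : Fin k)]
      · rw [if_pos]
        refine ⟨?_, ?_, h.1⟩
        · rw [← Equiv.Perm.eq_inv_iff_eq]; rfl
        · rw [← Equiv.Perm.eq_inv_iff_eq]; exact Fin.ext h.2.symm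
      · intro i _ hi
        rw [if_neg]
        intro h'
        exact hi (Fin.ext (by simp [← h'.1]))
      · simp
    · symm
      refine Finset.sum_eq_zero fun i _ => if_neg ?_
      rintro ⟨h1, h2, h3⟩
      refine h ⟨h3, ?_⟩
      rw [← h1, ← h2]
      simp
  rw [Finset.sum_congr rfl fun i _ => h1 i, Finset.sum_congr rfl fun l _ => h2 l, Finset.sum_comm]

theorem mallowsMean_sum_succession_le {k : ℕ} {q : ℝ} (hq : 0 < q) (hq1 : q ≤ 1) (a : ℕ) :
    mallowsMean (k + 1) q (fun v => ∑ i : Fin k,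
        if (v i.succ : ℕ) = v i.castSucc + 1 ∧ (v i.castSucc : ℕ) < a then (1 : ℝ) else 0)
      ≤ a * (2 / qInt q (k + 1)) := by
  have hr : 0 ≤ 2 / qInt q (k + 1) := div_nonneg zero_le_two (qInt_nonneg hq _)
  simp only [sum_succession_eq]
  rw [mallowsMean_inv (k + 1) q (fun v => ∑ l : Fin k, if (l : ℕ) < a then
          (if (v l.succ : ℕ) = v l.castSucc + 1 then 1 else 0) else 0), mallowsMean_sum]
  calc ∑ l : Fin k, mallowsMean (k + 1) q (fun v => if (l : ℕ) < a then
          (if (v l.succ : ℕ) = v l.castSucc + 1 then 1 else 0) else 0)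
      ≤ ∑ l : Fin k, if (l : ℕ) < a then 2 / qInt q (k + 1) else 0 := by
        refine Finset.sum_le_sum fun l _ => ?_
        by_cases hl : (l : ℕ) < a
        · simp only [hl, if_true]
          exact mallowsMean_succession_le hq hq1 l
        · simp only [hl, if_false]
          rw [mallowsMean_const _ hq]
    _ = (min k a : ℕ) * (2 / qInt q (k + 1)) := by
        rw [← Finset.sum_filter, Finset.sum_const, nsmul_eq_mul, Fin.card_filter_val_lt]
    _ ≤ a * (2 / qInt q (k + 1)) := by
        gcongr
        exact min_le_right _ _

/-! ### The variance of the sum of the increments -/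

theorem abs_tripleScore_le (x y z : ℕ) : |tripleScore x y z| ≤ 2 := by
  unfold tripleScore
  split_ifs <;> first | omega | norm_num

theorem prefixSeq_cons {n : ℕ} (x y : ℕ) (f : Fin (n + 1) → ℕ) {j : ℕ} (hj : j < n + 2) :
    prefixSeq x y f (j + 1) = prefixSeq y (f 0) (fun i => f i.succ) j := by
  match j, hj with
  | 0, _ => rfl
  | 1, _ => simp [prefixSeq]
  | j + 2, hj =>
    have h1 : j < n := by omega
    have h2 : j + 1 < n + 1 := by omega
    simp only [prefixSeq, h1, h2, dif_pos]
    rfl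

theorem totalScore_succ (n : ℕ) (S : ℕ → ℕ) :
    totalScore (n + 1) S = tripleScore (S 0) (S 1) (S 2) + totalScore n (fun j => S (j + 1)) := by
  rw [totalScore, Finset.sum_range_succ', add_comm, totalScore]

theorem totalScore_congr {n : ℕ} {S T : ℕ → ℕ} (h : ∀ j < n + 2, S j = T j) :
    totalScore n S = totalScore n T := by
  refine Finset.sum_congr rfl fun j hj => ?_
  rw [Finset.mem_range] at hj
  rw [h j (by omega), h (j + 1) (by omega), h (j + 2) (by omega)]

theorem totalScore_prefixSeq_succ {n : ℕ} (x y : ℕ) (f : Fin (n + 1) → ℕ) :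
    totalScore (n + 1) (prefixSeq x y f)
      = tripleScore x y (f 0) + totalScore n (prefixSeq y (f 0) fun i => f i.succ) := by
  rw [totalScore_succ, totalScore_congr (fun j hj => prefixSeq_cons x y f hj)]
  rfl

theorem abs_totalScore_sub_le (n : ℕ) (S : ℕ → ℕ) :
    |totalScore n S - totalScore (n - 2) (fun j => S (j + 2))| ≤ 4 := by
  match n with
  | 0 => simp [totalScore]
  | 1 =>
    have := abs_tripleScore_le (S 0) (S 1) (S 2)
    simp only [totalScore, Finset.range_one, Finset.sum_singleton, Nat.reduceSub,
      Finset.range_zero, Finset.sum_empty, sub_zero, zero_add]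
    linarith
  | n + 2 =>
    rw [totalScore_succ, totalScore_succ]
    have h1 := abs_tripleScore_le (S 0) (S 1) (S 2)
    have h2 := abs_tripleScore_le (S 1) (S 2) (S 3)
    simp only [Nat.add_sub_cancel, zero_add, Nat.reduceAdd, add_assoc]
    rw [abs_le] at *
    constructor <;> linarith

/-- The statistics of permutations that arise from the total score of triples by prescribing
finitely many initial values: `ρ` lists the values that remain, `x` and `y` are the last two
prescribed values. -/
def IsPartialScore (n : ℕ) (g : Equiv.Perm (Fin n) → ℝ) : Prop :=
  ∃ (ρ : Fin n → ℕ) (x y : ℕ) (k : ℝ), StrictMono ρ ∧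
    ∀ v, g v = k + totalScore n (prefixSeq x y fun i => ρ (v i))

theorem totalScore_consPerm {n : ℕ} (ρ : Fin (n + 1) → ℕ) (x y : ℕ) (a : Fin (n + 1))
    (v : Equiv.Perm (Fin n)) :
    totalScore (n + 1) (prefixSeq x y fun i => ρ (consPerm a v i))
      = tripleScore x y (ρ a)
        + totalScore n (prefixSeq y (ρ a) fun i => ρ (a.succAbove (v i))) := by
  rw [totalScore_prefixSeq_succ]
  simp

theorem IsPartialScore.consPerm {n : ℕ} {g : Equiv.Perm (Fin (n + 1)) → ℝ}
    (hg : IsPartialScore (n + 1) g) (a : Fin (n + 1)) :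
    IsPartialScore n (fun v => g (consPerm a v)) := by
  obtain ⟨ρ, x, y, k, hρ, h⟩ := hg
  refine ⟨fun i => ρ (a.succAbove i), y, ρ a, k + tripleScore x y (ρ a),
    hρ.comp (Fin.strictMono_succAbove a), fun v => ?_⟩
  exact (h _).trans (by rw [totalScore_consPerm, add_assoc])

/-- Whether the entries of `ρ` at two ranks are consecutive integers does not depend on whether
the entry at `a` or the one at `0` has been removed, except possibly for adjacent ranks
below `a`. -/
theorem succAbove_consecutive_iff {n : ℕ} {ρ : Fin (n + 1) → ℕ} (hρ : StrictMono ρ)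
    (a : Fin (n + 1)) {l l' : Fin n} (h : ¬((l' : ℕ) = l + 1 ∧ (l : ℕ) < a)) :
    ρ (a.succAbove l') = ρ (a.succAbove l) + 1 ↔
      ρ (Fin.succAbove 0 l') = ρ (Fin.succAbove 0 l) + 1 := by
  have key : ∀ b : Fin (n + 1), ρ (b.succAbove l') = ρ (b.succAbove l) + 1 →
      (l' : ℕ) = l + 1 := by
    intro b hb
    have hmono := hρ.comp (Fin.strictMono_succAbove b)
    have hlt : l < l' := hmono.lt_iff_lt.1 (by simp only [Function.comp_apply]; omega)
    by_contra hne
    rw [Fin.lt_def] at hlt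
    have hl' := l'.isLt
    let l'' : Fin n := ⟨l + 1, by omega⟩
    have h1 : l < l'' := by rw [Fin.lt_def]; simp only [l'']; omega
    have h2 : l'' < l' := by rw [Fin.lt_def]; simp only [l'']; omega
    have h3 := hmono h1
    have h4 := hmono h2
    simp only [Function.comp_apply] at h3 h4
    omega
  by_cases hl : (l' : ℕ) = l + 1
  · have hal : (a : ℕ) ≤ l := by
      by_contra h'
      exact h ⟨hl, by omega⟩
    rw [Fin.succAbove_of_le_castSucc a l (by rw [Fin.le_def]; simpa using hal),
      Fin.succAbove_of_le_castSucc a l' (by rw [Fin.le_def, Fin.val_castSucc]; omega),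
      Fin.succAbove_zero]
  · exact ⟨fun h' => absurd (key _ h') hl, fun h' => absurd (key _ h') hl⟩

theorem abs_tripleScore_sub_le {n : ℕ} {ρ : Fin (n + 1) → ℕ} (hρ : StrictMono ρ)
    (a : Fin (n + 1)) (i j l : Fin n) :
    |tripleScore (ρ (a.succAbove i)) (ρ (a.succAbove j)) (ρ (a.succAbove l))
        - tripleScore (ρ (Fin.succAbove 0 i)) (ρ (Fin.succAbove 0 j)) (ρ (Fin.succAbove 0 l))|
      ≤ if (l : ℕ) = j + 1 ∧ (j : ℕ) < a then 1 else 0 := by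
  have hlt : ∀ (b : Fin (n + 1)) (s t : Fin n), ρ (b.succAbove s) < ρ (b.succAbove t) ↔ s < t :=
    fun b s t => (hρ.comp (Fin.strictMono_succAbove b)).lt_iff_lt
  unfold tripleScore
  simp only [hlt]
  have h1 : ∀ p r s t u : ℝ, p + t - r - s - (p + u - r - s) = t - u := by intros; ring
  rw [h1]
  by_cases h : (l : ℕ) = j + 1 ∧ (j : ℕ) < a
  · rw [if_pos h]
    split_ifs <;> norm_num
  · rw [if_neg h]
    simp only [succAbove_consecutive_iff hρ a h, sub_self, abs_zero, le_refl]

/-- Prescribing the first value `a` instead of `0` affects the score of the triples of remaining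
values only through the successions among the values below `a`. -/
theorem abs_totalScore_sub_zero_le {k : ℕ} {ρ : Fin (k + 2) → ℕ} (hρ : StrictMono ρ) (x y x' y' : ℕ)
    (a : Fin (k + 2)) (v : Equiv.Perm (Fin (k + 1))) :
    |totalScore (k + 1 - 2) (fun j => prefixSeq x y (fun i => ρ (a.succAbove (v i))) (j + 2))
        - totalScore (k + 1 - 2)
            (fun j => prefixSeq x' y' (fun i => ρ (Fin.succAbove 0 (v i))) (j + 2))|
      ≤ ∑ i : Fin k, if (v i.succ : ℕ) = v i.castSucc + 1 ∧ (v i.castSucc : ℕ) < a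
          then (1 : ℝ) else 0 := by
  match k with
  | 0 => simp [totalScore]
  | k + 1 =>
    rw [show k + 1 + 1 - 2 = k by omega, totalScore, totalScore, ← Finset.sum_sub_distrib]
    refine (Finset.abs_sum_le_sum_abs _ _).trans ?_
    rw [Finset.sum_range, Fin.sum_univ_succ (n := k)]
    refine le_add_of_nonneg_of_le (by positivity) (Finset.sum_le_sum fun i _ => ?_)
    have e : ∀ (x y : ℕ) (f : Fin (k + 1 + 1) → ℕ),
        prefixSeq x y f (i + 2) = f i.castSucc.castSucc
        ∧ prefixSeq x y f (i + 1 + 2) = f i.succ.castSucc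
        ∧ prefixSeq x y f (i + 2 + 2) = f i.succ.succ := fun x y f =>
      ⟨prefixSeq_val x y f i.castSucc.castSucc, prefixSeq_val x y f i.succ.castSucc,
        prefixSeq_val x y f i.succ.succ⟩
    simp only [(e _ _ _).1, (e _ _ _).2.1, (e _ _ _).2.2]
    exact abs_tripleScore_sub_le hρ a _ _ _

theorem IsPartialScore.exists_firstMean_le {q : ℝ} (hq : 0 < q) (hq1 : q ≤ 1) (k : ℕ)
    (g : Equiv.Perm (Fin (k + 2)) → ℝ) (hg : IsPartialScore (k + 2) g) : ∃ c,
      firstMean (k + 1) q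
        (fun a => (mallowsMean (k + 1) q (fun v => g (Mallows.consPerm a v)) - c) ^ 2) ≤ 136 := by
  obtain ⟨ρ, x, y, d, hρ, h⟩ := hg
  set I : Fin (k + 2) → Equiv.Perm (Fin (k + 1)) → ℝ := fun a v => totalScore (k + 1 - 2)
    (fun j => prefixSeq y (ρ a) (fun i => ρ (a.succAbove (v i))) (j + 2)) with hI
  refine ⟨d + mallowsMean (k + 1) q (I 0), ?_⟩
  set Q := qInt q (k + 1) with hQ
  have hQ1 : 1 ≤ Q := one_le_qInt_succ hq k
  have hQ0 : 0 < Q := by linarith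
  have hX : ∀ a : Fin (k + 2), |mallowsMean (k + 1) q (fun v => g (Mallows.consPerm a v))
      - (d + mallowsMean (k + 1) q (I 0))| ≤ 6 + (a : ℕ) * (2 / Q) := by
    intro a
    have h1 : mallowsMean (k + 1) q (fun v => g (Mallows.consPerm a v))
        - (d + mallowsMean (k + 1) q (I 0))
        = mallowsMean (k + 1) q (fun v => g (Mallows.consPerm a v) - (d + I 0 v)) := by
      rw [mallowsMean_sub, mallowsMean_add, mallowsMean_const _ hq]
    rw [h1]
    refine (abs_mallowsMean_le _ hq _).trans ?_
    have h2 := mallowsMean_sum_succession_le hq hq1 (k := k) (a : ℕ)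
    refine le_trans (mallowsMean_mono _ hq (g := fun v => 6 + ∑ i : Fin k,
      if (v i.succ : ℕ) = v i.castSucc + 1 ∧ (v i.castSucc : ℕ) < a then (1 : ℝ) else 0)
      fun v => ?_) (by rw [mallowsMean_add, mallowsMean_const _ hq]; linarith)
    rw [h, totalScore_consPerm]
    have h3 := abs_tripleScore_le x y (ρ a)
    have h4 := abs_totalScore_sub_le (k + 1)
      (prefixSeq y (ρ a) (fun i => ρ (a.succAbove (v i))))
    have h5 := abs_totalScore_sub_zero_le hρ y (ρ a) y (ρ 0) a v
    simp only [hI]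
    rw [abs_le] at *
    constructor <;> linarith
  have hsq : ∀ a : Fin (k + 2), (mallowsMean (k + 1) q (fun v => g (Mallows.consPerm a v))
      - (d + mallowsMean (k + 1) q (I 0))) ^ 2 ≤ 72 + 8 / Q ^ 2 * ((a : ℕ) : ℝ) ^ 2 := by
    intro a
    rw [← sq_abs]
    refine (pow_le_pow_left₀ (abs_nonneg _) (hX a) 2).trans ?_
    have : 8 / Q ^ 2 * ((a : ℕ) : ℝ) ^ 2 = 2 * ((a : ℕ) * (2 / Q)) ^ 2 := by ring
    rw [this]
    nlinarith [sq_nonneg (6 - ((a : ℕ) : ℝ) * (2 / Q))]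
  refine (firstMean_mono _ hq hsq).trans ?_
  rw [firstMean_add, firstMean_const _ hq, firstMean_const_mul]
  have h6 := firstMean_sq_le (n := k + 1) hq
  have h7 : qInt q (k + 1 + 1) ≤ 2 * Q := by
    rw [qInt_succ]
    nlinarith
  have h8 : qInt q (k + 1 + 1) ^ 2 ≤ (2 * Q) ^ 2 := by
    have := qInt_nonneg hq (k + 1 + 1)
    gcongr
  calc 72 + 8 / Q ^ 2 * firstMean (k + 1) q (fun a => ((a : ℕ) : ℝ) ^ 2)
      ≤ 72 + 8 / Q ^ 2 * (2 * (2 * Q) ^ 2) := by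
        gcongr
        linarith
    _ = 136 := by field_simp; norm_num

/-- The variance of the sum of the increments grows at most linearly, uniformly in `q ≤ 1`. -/
theorem mallowsVar_sum_increment_le {q : ℝ} (hq : 0 < q) (hq1 : q ≤ 1) (m : ℕ) :
    mallowsVar (m + 1) q (fun w => ∑ i, increment i w) ≤ 136 * m := by
  refine mallowsVar_le_of_consPerm hq IsPartialScore (fun n g hg a => hg.consPerm a)
    (fun n g hg => hg.exists_firstMean_le hq hq1) m _ ?_
  exact ⟨fun i => i, m + 1, m + 1, 0, fun i j h => h, fun v =>
    (sum_increment v).trans (zero_add _).symm⟩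

/-! ### Gaussian tails -/

/-- A continuous function whose derivative is bounded by `L` off a countable set is
`L`-Lipschitz. -/
theorem abs_sub_le_of_abs_deriv_le_off_countable {F : ℝ → ℝ} (hF : Continuous F) {S : Set ℝ}
    (hS : S.Countable) {L : ℝ} (hd : ∀ x ∉ S, DifferentiableAt ℝ F x)
    (hL : ∀ x ∉ S, |deriv F x| ≤ L) (a b : ℝ) : |F b - F a| ≤ L * |b - a| := by
  have hbound : ∀ᵐ x, ‖deriv F x‖ ≤ L := by
    filter_upwards [hS.ae_notMem volume] with x hx using hL x hx
  have hint : IntervalIntegrable (deriv F) volume a b := by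
    refine (intervalIntegrable_const (c := L)).mono_fun
      (measurable_deriv F).aestronglyMeasurable ?_
    refine ae_restrict_of_ae ?_
    filter_upwards [hbound] with x hx
    exact hx.trans (le_abs_self L)
  rw [← integral_eq_of_hasDerivAt_off_countable F (deriv F) hS hF.continuousOn
    (fun x hx => (hd x hx.2).hasDerivAt) hint]
  rw [← Real.norm_eq_abs]
  refine intervalIntegral.norm_integral_le_of_norm_le_const_ae ?_
  filter_upwards [hbound] with x hx _ using hx

/-- The unnormalized standard Gaussian density. -/
noncomputable def gaussWeight (x : ℝ) : ℝ :=
  Real.exp (-(1 / 2) * x ^ 2)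

theorem gaussWeight_pos (x : ℝ) : 0 < gaussWeight x :=
  Real.exp_pos _

theorem continuous_gaussWeight : Continuous gaussWeight := by
  unfold gaussWeight; fun_prop

theorem gaussWeight_neg (x : ℝ) : gaussWeight (-x) = gaussWeight x := by
  simp [gaussWeight]

theorem hasDerivAt_gaussWeight (x : ℝ) : HasDerivAt gaussWeight (-x * gaussWeight x) x := by
  unfold gaussWeight
  have h : HasDerivAt (fun x : ℝ => -(1 / 2) * x ^ 2) (-x) x := by
    refine ((hasDerivAt_pow 2 x).const_mul (-(1 / 2) : ℝ)).congr_deriv ?_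
    push_cast; ring
  convert h.exp using 1
  ring

theorem integrable_gaussWeight : Integrable gaussWeight :=
  integrable_exp_neg_mul_sq (by norm_num)

theorem integrable_id_mul_gaussWeight : Integrable (fun x => x * gaussWeight x) :=
  integrable_mul_exp_neg_mul_sq (by norm_num)

theorem tendsto_gaussWeight : Filter.Tendsto gaussWeight Filter.atTop (nhds 0) := by
  refine Real.tendsto_exp_atBot.comp ?_
  exact (Filter.tendsto_pow_atTop two_ne_zero).const_mul_atTop_of_neg (by norm_num)

theorem integral_Ioi_id_mul_gaussWeight (x : ℝ) :
    ∫ y in Set.Ioi x, y * gaussWeight y = gaussWeight x := by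
  have h := integral_Ioi_of_hasDerivAt_of_tendsto' (f := fun y => -gaussWeight y)
    (f' := fun y => y * gaussWeight y) (a := x) (m := 0)
    (fun y _ => (hasDerivAt_gaussWeight y).neg.congr_deriv (by ring))
    integrable_id_mul_gaussWeight.integrableOn (by simpa using tendsto_gaussWeight.neg)
  rw [h]; ring

theorem integral_Ioi_gaussWeight_le {x : ℝ} (hx : 0 ≤ x) :
    ∫ y in Set.Ioi x, gaussWeight y ≤ 13 / 10 * gaussWeight x := by
  have h1 : ∫ y in Set.Ioi x, gaussWeight y = ∫ y in Set.Ioi 0, gaussWeight (y + x) := by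
    have := (measurePreserving_add_right volume x).setIntegral_preimage_emb
      (measurableEmbedding_addRight x) gaussWeight (Set.Ioi x)
    rw [← this]
    simp
  have h2 : ∫ y in Set.Ioi 0, gaussWeight (y + x)
      ≤ ∫ y in Set.Ioi 0, gaussWeight x * gaussWeight y := by
    refine setIntegral_mono_on (integrable_gaussWeight.comp_add_right x).integrableOn
      (integrable_gaussWeight.const_mul _).integrableOn measurableSet_Ioi fun y hy => ?_
    rw [gaussWeight, gaussWeight, gaussWeight, ← Real.exp_add]
    have : 0 ≤ y * x := mul_nonneg (le_of_lt hy) hx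
    exact Real.exp_le_exp.2 (by nlinarith)
  have h3 : ∫ y in Set.Ioi 0, gaussWeight y ≤ 13 / 10 := by
    have := integral_gaussian_Ioi (1 / 2)
    simp only [gaussWeight]
    rw [this, div_le_iff₀ two_pos, Real.sqrt_le_left (by norm_num)]
    have := Real.pi_lt_d2
    linarith
  rw [h1]
  refine h2.trans ?_
  rw [integral_const_mul, mul_comm]
  exact mul_le_mul_of_nonneg_right h3 (gaussWeight_pos x).le

theorem mul_integral_Ioi_gaussWeight_le (x : ℝ) :
    x * ∫ y in Set.Ioi x, gaussWeight y ≤ gaussWeight x := by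
  rw [← integral_Ioi_id_mul_gaussWeight x, ← integral_const_mul]
  exact setIntegral_mono_on (integrable_gaussWeight.const_mul _).integrableOn
    integrable_id_mul_gaussWeight.integrableOn measurableSet_Ioi fun y hy =>
      mul_le_mul_of_nonneg_right (le_of_lt hy) (gaussWeight_pos y).le

/-- The lower bound for the Mills ratio: `x / (1 + x ^ 2)` times the density has a derivative that
is at most the density in absolute value. -/
theorem mul_gaussWeight_le (x : ℝ) :
    x * gaussWeight x ≤ (1 + x ^ 2) * ∫ y in Set.Ioi x, gaussWeight y := by
  have hpos : ∀ y : ℝ, 0 < 1 + y ^ 2 := fun y => by positivity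
  have hderiv : ∀ y ∈ Set.Ici x, HasDerivAt (fun y => -(y / (1 + y ^ 2)) * gaussWeight y)
      ((1 - 2 / (1 + y ^ 2) ^ 2) * gaussWeight y) y := by
    intro y _
    have h1 : HasDerivAt (fun y : ℝ => 1 + y ^ 2) (2 * y) y := by
      refine ((hasDerivAt_pow 2 y).const_add 1).congr_deriv ?_
      push_cast; ring
    have h2 := (((hasDerivAt_id y).div h1 (hpos y).ne').neg).mul (hasDerivAt_gaussWeight y)
    refine h2.congr_deriv ?_
    have := (hpos y).ne'
    simp only [id, Pi.neg_apply, Pi.div_apply]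
    field_simp
    ring
  have hle : ∀ y : ℝ, |1 - 2 / (1 + y ^ 2) ^ 2| ≤ 1 := by
    intro y
    have h1 : 2 / (1 + y ^ 2) ^ 2 ≤ 2 := by
      rw [div_le_iff₀ (by positivity)]
      nlinarith [sq_nonneg y, sq_nonneg (y ^ 2)]
    have h2 : 0 ≤ 2 / (1 + y ^ 2) ^ 2 := by positivity
    rw [abs_le]
    constructor <;> linarith
  have hint : Integrable (fun y => (1 - 2 / (1 + y ^ 2) ^ 2) * gaussWeight y) := by
    refine integrable_gaussWeight.mono' ?_ (Filter.Eventually.of_forall fun y => ?_)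
    · refine Continuous.aestronglyMeasurable ?_
      refine Continuous.mul ?_ continuous_gaussWeight
      refine continuous_const.sub (continuous_const.div (by fun_prop) fun y => ?_)
      exact pow_ne_zero 2 (hpos y).ne'
    · rw [norm_mul, Real.norm_eq_abs, Real.norm_of_nonneg (gaussWeight_pos y).le]
      exact mul_le_of_le_one_left (gaussWeight_pos y).le (hle y)
  have htend : Filter.Tendsto (fun y => -(y / (1 + y ^ 2)) * gaussWeight y) Filter.atTop
      (nhds 0) := by
    refine squeeze_zero_norm (fun y => ?_) tendsto_gaussWeight
    rw [norm_mul, norm_neg, Real.norm_of_nonneg (gaussWeight_pos y).le, Real.norm_eq_abs]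
    refine mul_le_of_le_one_left (gaussWeight_pos y).le ?_
    rw [abs_div, abs_of_pos (hpos y), div_le_one (hpos y)]
    nlinarith [sq_nonneg (|y| - 1), sq_abs y, abs_nonneg y]
  have h := integral_Ioi_of_hasDerivAt_of_tendsto' hderiv hint.integrableOn htend
  have h2 : ∫ y in Set.Ioi x, (1 - 2 / (1 + y ^ 2) ^ 2) * gaussWeight y
      ≤ ∫ y in Set.Ioi x, gaussWeight y :=
    setIntegral_mono_on hint.integrableOn integrable_gaussWeight.integrableOn measurableSet_Ioi
      fun y _ => mul_le_of_le_one_left (gaussWeight_pos y).le ((abs_le.1 (hle y)).2)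
  rw [h] at h2
  have h3 : x / (1 + x ^ 2) * gaussWeight x ≤ ∫ y in Set.Ioi x, gaussWeight y := by linarith
  calc x * gaussWeight x = (1 + x ^ 2) * (x / (1 + x ^ 2) * gaussWeight x) := by
        have := (hpos x).ne'; field_simp
    _ ≤ _ := by gcongr

/-- The tail integral of `g` against the Gaussian weight beyond `x`, divided by the weight
at `x`. For `g = 1` this is the Mills ratio. -/
noncomputable def gaussTail (g : ℝ → ℝ) (x : ℝ) : ℝ :=
  (∫ y in Set.Ioi x, g y * gaussWeight y) / gaussWeight x

theorem mills_le {x : ℝ} (hx : 0 ≤ x) : gaussTail (fun _ => 1) x ≤ 13 / 10 := by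
  rw [gaussTail, div_le_iff₀ (gaussWeight_pos x)]
  simpa using integral_Ioi_gaussWeight_le hx

theorem mul_mills_le (x : ℝ) : x * gaussTail (fun _ => 1) x ≤ 1 := by
  rw [gaussTail, ← mul_div_assoc, div_le_one (gaussWeight_pos x)]
  simpa using mul_integral_Ioi_gaussWeight_le x

theorem le_mul_mills (x : ℝ) : x ≤ (1 + x ^ 2) * gaussTail (fun _ => 1) x := by
  rw [gaussTail, ← mul_div_assoc, le_div_iff₀ (gaussWeight_pos x)]
  simpa using mul_gaussWeight_le x

theorem integrable_mul_gaussWeight {g : ℝ → ℝ} (hg : Continuous g) {B : ℝ}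
    (hB : ∀ x, |g x| ≤ B) : Integrable (fun x => g x * gaussWeight x) := by
  refine (integrable_gaussWeight.const_mul B).mono'
    (hg.mul continuous_gaussWeight).aestronglyMeasurable (Filter.Eventually.of_forall fun y => ?_)
  rw [norm_mul, Real.norm_of_nonneg (gaussWeight_pos y).le]
  exact mul_le_mul_of_nonneg_right (hB y) (gaussWeight_pos y).le

theorem abs_gaussTail_le {g : ℝ → ℝ} {B : ℝ} (hB : ∀ x, |g x| ≤ B) (x : ℝ) :
    |gaussTail g x| ≤ B * gaussTail (fun _ => 1) x := by
  simp only [gaussTail, one_mul]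
  rw [abs_div, abs_of_pos (gaussWeight_pos x), ← mul_div_assoc, ← integral_const_mul,
    ← Real.norm_eq_abs]
  refine div_le_div_of_nonneg_right ?_ (gaussWeight_pos x).le
  refine norm_integral_le_of_norm_le (integrable_gaussWeight.const_mul B).integrableOn
    (Filter.Eventually.of_forall fun y => ?_)
  rw [norm_mul, Real.norm_of_nonneg (gaussWeight_pos y).le]
  exact mul_le_mul_of_nonneg_right (hB y) (gaussWeight_pos y).le

theorem abs_mul_gaussTail_le {g : ℝ → ℝ} {B : ℝ} (hB : ∀ x, |g x| ≤ B) {x : ℝ} (hx : 0 ≤ x) :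
    |x * gaussTail g x| ≤ B := by
  have hB0 : 0 ≤ B := (abs_nonneg _).trans (hB 0)
  rw [abs_mul, abs_of_nonneg hx]
  calc x * |gaussTail g x| ≤ x * (B * gaussTail (fun _ => 1) x) := by
        gcongr; exact abs_gaussTail_le hB x
    _ = B * (x * gaussTail (fun _ => 1) x) := by ring
    _ ≤ B * 1 := by gcongr; exact mul_mills_le x
    _ = B := mul_one B

theorem abs_gaussTail_sub_le {g : ℝ → ℝ} (hg : Continuous g) {B K : ℝ} (hB : ∀ x, |g x| ≤ B)
    (hK : ∀ a b, |g b - g a| ≤ K * |b - a|) (x : ℝ) :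
    |gaussTail g x - g x * gaussTail (fun _ => 1) x| ≤ K * (1 - x * gaussTail (fun _ => 1) x) := by
  have hw := gaussWeight_pos x
  have h1 : gaussTail g x - g x * gaussTail (fun _ => 1) x
      = (∫ y in Set.Ioi x, (g y - g x) * gaussWeight y) / gaussWeight x := by
    rw [gaussTail, gaussTail, ← mul_div_assoc, ← sub_div, ← integral_const_mul, ← integral_sub
      (integrable_mul_gaussWeight hg hB).integrableOn
      ((integrable_gaussWeight.const_mul (g x)).integrableOn.congr_fun (fun y _ => by ring)
        measurableSet_Ioi)]
    congr 2
    ext y; ring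
  have hyx : Integrable (fun y => (y - x) * gaussWeight y) := by
    refine (integrable_id_mul_gaussWeight.sub (integrable_gaussWeight.const_mul x)).congr
      (Filter.Eventually.of_forall fun y => ?_)
    simp only [Pi.sub_apply]; ring
  have h2 : K * (1 - x * gaussTail (fun _ => 1) x)
      = (∫ y in Set.Ioi x, K * ((y - x) * gaussWeight y)) / gaussWeight x := by
    rw [integral_const_mul, gaussTail]
    have : ∫ y in Set.Ioi x, (y - x) * gaussWeight y
        = gaussWeight x - x * ∫ y in Set.Ioi x, gaussWeight y := by
      simp only [sub_mul]
      rw [integral_sub integrable_id_mul_gaussWeight.integrableOn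
        (integrable_gaussWeight.const_mul x).integrableOn, integral_Ioi_id_mul_gaussWeight,
        integral_const_mul]
    rw [this]
    simp only [one_mul]
    field_simp
  rw [h1, h2, abs_div, abs_of_pos hw, ← Real.norm_eq_abs]
  refine div_le_div_of_nonneg_right ?_ hw.le
  refine norm_integral_le_of_norm_le (hyx.const_mul K).integrableOn
    ((ae_restrict_mem measurableSet_Ioi).mono fun y hy => ?_)
  rw [norm_mul, Real.norm_of_nonneg (gaussWeight_pos y).le, ← mul_assoc]
  refine mul_le_mul_of_nonneg_right ?_ (gaussWeight_pos y).le
  have := hK x y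
  rwa [abs_of_pos (show 0 < y - x from sub_pos.2 hy)] at this

/-- The bound behind the second derivative estimate for the Stein equation. -/
theorem abs_one_add_sq_mul_gaussTail_sub_le {g : ℝ → ℝ} (hg : Continuous g) {B K : ℝ}
    (hB : ∀ x, |g x| ≤ B) (hK : ∀ a b, |g b - g a| ≤ K * |b - a|) {x : ℝ} (hx : 0 ≤ x)
    (hgx : |g x| ≤ K * (x + 1)) :
    |(1 + x ^ 2) * gaussTail g x - x * g x| ≤ 21 / 5 * K := by
  set M := gaussTail (fun _ => 1) x with hM
  have h1 := mills_le hx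
  have h2 := mul_mills_le x
  have h3 := le_mul_mills x
  have h4 := abs_gaussTail_sub_le hg hB hK x
  rw [← hM] at h1 h2 h3 h4
  have hK0 : 0 ≤ K := by
    have := (abs_nonneg _).trans hgx
    nlinarith
  have h5 : (x + 1) * ((1 + x ^ 2) * M - x) ≤ 16 / 5 := by
    rcases le_total x 1 with h | h
    · have h6 : (1 + x ^ 2) * M - x ≤ 8 / 5 := by
        have : (1 + x ^ 2) * M ≤ (1 + x ^ 2) * (13 / 10) := by gcongr
        nlinarith
      nlinarith
    · have h6 : x * ((1 + x ^ 2) * M - x) ≤ 1 := by nlinarith [sq_nonneg x]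
      nlinarith
  have h7 : (1 + x ^ 2) * (1 - x * M) ≤ 1 := by nlinarith
  have e : (1 + x ^ 2) * gaussTail g x - x * g x
      = g x * ((1 + x ^ 2) * M - x) + (1 + x ^ 2) * (gaussTail g x - g x * M) := by ring
  rw [e]
  refine (abs_add_le _ _).trans ?_
  rw [abs_mul, abs_mul, abs_of_nonneg (sub_nonneg.2 h3), abs_of_nonneg (by positivity : 0 ≤ 1 + x ^ 2)]
  calc |g x| * ((1 + x ^ 2) * M - x) + (1 + x ^ 2) * |gaussTail g x - g x * M|
      ≤ K * (x + 1) * ((1 + x ^ 2) * M - x) + (1 + x ^ 2) * (K * (1 - x * M)) := by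
        gcongr
    _ = K * ((x + 1) * ((1 + x ^ 2) * M - x)) + K * ((1 + x ^ 2) * (1 - x * M)) := by ring
    _ ≤ K * (16 / 5) + K * 1 := by gcongr
    _ = 21 / 5 * K := by ring

/-! ### The Stein equation -/

theorem integral_mul_gaussWeight_eq_zero {g : ℝ → ℝ} (h : ∫ z, g z ∂(gaussianReal 0 1) = 0) :
    ∫ y, g y * gaussWeight y = 0 := by
  rw [integral_gaussianReal_eq_integral_smul one_ne_zero] at h
  have e : ∀ y, gaussianPDFReal 0 1 y • g y
      = (Real.sqrt (2 * Real.pi * 1))⁻¹ * (g y * gaussWeight y) := by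
    intro y
    rw [gaussianPDFReal, gaussWeight, smul_eq_mul, sub_zero,
      show -y ^ 2 / (2 * ((1 : NNReal) : ℝ)) = -(1 / 2) * y ^ 2 by push_cast; ring]
    push_cast
    ring
  simp only [e] at h
  rw [integral_const_mul] at h
  exact (mul_eq_zero.1 h).resolve_left (by positivity)

theorem integral_abs_gaussianReal_le : ∫ z, |z| ∂(gaussianReal 0 1) ≤ 1 := by
  have hL : MemLp (fun z : ℝ => z) 2 (gaussianReal 0 1) := memLp_id_gaussianReal 2
  have h2 : ∫ z, z ^ 2 ∂(gaussianReal 0 1) = 1 := by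
    have h := variance_of_integral_eq_zero (μ := gaussianReal 0 1) (X := fun z : ℝ => z)
      aemeasurable_id (by simp)
    rw [variance_fun_id_gaussianReal] at h
    simpa using h.symm
  have hi : Integrable (fun z : ℝ => z ^ 2) (gaussianReal 0 1) := hL.integrable_sq
  calc ∫ z, |z| ∂(gaussianReal 0 1)
      ≤ ∫ z, (1 / 2 + 1 / 2 * z ^ 2) ∂(gaussianReal 0 1) := by
        refine integral_mono (hL.integrable one_le_two).abs
          ((integrable_const _).add (hi.const_mul _)) fun z => ?_
        nlinarith [sq_nonneg (|z| - 1), sq_abs z]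
    _ = 1 := by
        rw [integral_add (integrable_const _) (hi.const_mul _), integral_const_mul, h2]
        simp
        norm_num

theorem abs_sub_integral_gaussianReal_le {h : ℝ → ℝ} (hc : Continuous h) {A K : ℝ}
    (hA : ∀ x, |h x| ≤ A) (hK : ∀ a b, |h b - h a| ≤ K * |b - a|) (x : ℝ) :
    |h x - ∫ z, h z ∂(gaussianReal 0 1)| ≤ K * (|x| + 1) := by
  have hi : Integrable h (gaussianReal 0 1) :=
    Integrable.of_bound hc.aestronglyMeasurable A (Filter.Eventually.of_forall hA)
  have hL : Integrable (fun z : ℝ => |z|) (gaussianReal 0 1) :=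
    ((memLp_id_gaussianReal 1).integrable le_rfl).abs
  have hK0 : 0 ≤ K := by
    have := (abs_nonneg _).trans (hK 0 1)
    simpa using this
  have e : h x - ∫ z, h z ∂(gaussianReal 0 1) = ∫ z, (h x - h z) ∂(gaussianReal 0 1) := by
    rw [integral_sub (integrable_const _) hi]; simp
  rw [e, ← Real.norm_eq_abs]
  calc ‖∫ z, (h x - h z) ∂(gaussianReal 0 1)‖
      ≤ ∫ z, K * (|x| + |z|) ∂(gaussianReal 0 1) := by
        refine norm_integral_le_of_norm_le (((integrable_const _).add hL).const_mul K)
          (Filter.Eventually.of_forall fun z => ?_)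
        exact (hK z x).trans (mul_le_mul_of_nonneg_left (abs_sub _ _) hK0)
    _ = K * (|x| + ∫ z, |z| ∂(gaussianReal 0 1)) := by
        rw [integral_const_mul, integral_add (integrable_const _) hL]; simp
    _ ≤ K * (|x| + 1) := by
        gcongr; exact integral_abs_gaussianReal_le

theorem gaussTail_neg {g : ℝ → ℝ} (hg : Continuous g) {B : ℝ} (hB : ∀ x, |g x| ≤ B)
    (h0 : ∫ y, g y * gaussWeight y = 0) (x : ℝ) :
    gaussTail g x = -gaussTail (fun y => g (-y)) (-x) := by
  have hi := integrable_mul_gaussWeight hg hB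
  have h1 := intervalIntegral.integral_Iic_add_Ioi (b := x) hi.integrableOn hi.integrableOn
  have h2 := integral_comp_neg_Iic x (fun y => g (-y) * gaussWeight (-y))
  simp only [neg_neg] at h2
  rw [h0, h2] at h1
  simp only [gaussTail, gaussWeight_neg] at h1 ⊢
  rw [← neg_div]
  congr 1
  linarith

theorem hasDerivAt_gaussTail {g : ℝ → ℝ} (hg : Continuous g) {B : ℝ} (hB : ∀ x, |g x| ≤ B)
    (x : ℝ) : HasDerivAt (gaussTail g) (x * gaussTail g x - g x) x := by
  have hi := integrable_mul_gaussWeight hg hB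
  have hc : Continuous (fun y => g y * gaussWeight y) := hg.mul continuous_gaussWeight
  have e : ∀ x, ∫ y in Set.Ioi x, g y * gaussWeight y
      = (∫ y in Set.Ioi 0, g y * gaussWeight y) - ∫ y in (0 : ℝ)..x, g y * gaussWeight y := by
    intro x
    have h1 := intervalIntegral.integral_Iic_add_Ioi (b := x) hi.integrableOn hi.integrableOn
    have h2 := intervalIntegral.integral_Iic_add_Ioi (b := 0) hi.integrableOn hi.integrableOn
    have h3 := intervalIntegral.integral_Iic_sub_Iic (a := 0) (b := x) hi.integrableOn
      hi.integrableOn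
    linarith
  have hd : HasDerivAt (fun x => ∫ y in Set.Ioi x, g y * gaussWeight y)
      (-(g x * gaussWeight x)) x := by
    rw [funext e]
    exact (hc.integral_hasStrictDerivAt 0 x).hasDerivAt.const_sub _
  have hw := (gaussWeight_pos x).ne'
  refine (hd.div (hasDerivAt_gaussWeight x) hw).congr_deriv ?_
  unfold gaussTail
  field_simp
  ring

/-- The solution of the Stein equation for a bounded Lipschitz test function that is
differentiable off a countable set, together with its derivative: the derivative is bounded by a
multiple of the supremum of the test function, and is Lipschitz with a constant proportional to
that of the test function. -/
theorem exists_stein_solution {h : ℝ → ℝ} (hc : Continuous h) {S : Set ℝ} (hS : S.Countable)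
    (hd : ∀ x ∉ S, DifferentiableAt ℝ h x) {A K : ℝ} (hA : ∀ x, |h x| ≤ A)
    (hK : ∀ a b, |h b - h a| ≤ K * |b - a|) (hK' : ∀ x ∉ S, |deriv h x| ≤ K) :
    ∃ f f' : ℝ → ℝ, (∀ x, HasDerivAt f (f' x) x) ∧
      (∀ x, f' x - x * f x = h x - ∫ z, h z ∂(gaussianReal 0 1)) ∧
      (∀ x, |f' x| ≤ 4 * A) ∧ ∀ a b, |f' b - f' a| ≤ 26 / 5 * K * |b - a| := by
  set E := ∫ z, h z ∂(gaussianReal 0 1) with hE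
  have hA0 : 0 ≤ A := (abs_nonneg _).trans (hA 0)
  have hi : Integrable h (gaussianReal 0 1) :=
    Integrable.of_bound hc.aestronglyMeasurable A (Filter.Eventually.of_forall hA)
  have hEA : |E| ≤ A := by
    have := norm_integral_le_of_norm_le_const (μ := gaussianReal 0 1) (f := h)
      (Filter.Eventually.of_forall hA)
    simpa using this
  set g : ℝ → ℝ := fun x => h x - E with hg
  have hgc : Continuous g := hc.sub continuous_const
  have hgB : ∀ x, |g x| ≤ 2 * A := fun x => by
    have := abs_sub (h x) E
    have := hA x
    simp only [hg]
    linarith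
  have hgK : ∀ a b, |g b - g a| ≤ K * |b - a| := fun a b => by
    simpa [hg] using hK a b
  have hgx : ∀ x, |g x| ≤ K * (|x| + 1) := abs_sub_integral_gaussianReal_le hc hA hK
  have h0 : ∫ y, g y * gaussWeight y = 0 := by
    refine integral_mul_gaussWeight_eq_zero ?_
    simp only [hg]
    rw [integral_sub hi (integrable_const _)]
    simp [hE]
  set r : ℝ → ℝ := fun y => g (-y) with hr
  have hrc : Continuous r := hgc.comp continuous_neg
  have hrB : ∀ x, |r x| ≤ 2 * A := fun x => hgB (-x)
  have hrK : ∀ a b, |r b - r a| ≤ K * |b - a| := fun a b => by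
    have := hgK (-a) (-b)
    rwa [show -b - -a = -(b - a) by ring, abs_neg] at this
  have hneg := gaussTail_neg hgc hgB h0
  -- The two estimates hold for nonnegative arguments and carry over by reflection.
  have hb1 : ∀ x, |x * gaussTail g x| ≤ 2 * A := by
    intro x
    rcases le_total 0 x with hx | hx
    · exact abs_mul_gaussTail_le hgB hx
    · have := abs_mul_gaussTail_le hrB (neg_nonneg.2 hx)
      rw [hneg x]
      rwa [neg_mul, ← mul_neg] at this
  have hb2 : ∀ x, |(1 + x ^ 2) * gaussTail g x - x * g x| ≤ 21 / 5 * K := by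
    intro x
    rcases le_total 0 x with hx | hx
    · refine abs_one_add_sq_mul_gaussTail_sub_le hgc hgB hgK hx ?_
      have := hgx x
      rwa [abs_of_nonneg hx] at this
    · have h1 := abs_one_add_sq_mul_gaussTail_sub_le hrc hrB hrK (neg_nonneg.2 hx) (by
        have := hgx x
        rw [abs_of_nonpos hx] at this
        simpa [hr] using this)
      rw [hneg x]
      rw [← abs_neg]
      convert h1 using 2
      simp only [hr, neg_neg]
      ring
  set f : ℝ → ℝ := fun x => -gaussTail g x with hf
  set f' : ℝ → ℝ := fun x => x * f x + g x with hf'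
  have hfd : ∀ x, HasDerivAt f (f' x) x := fun x =>
    (hasDerivAt_gaussTail hgc hgB x).neg.congr_deriv (by simp only [hf', hf]; ring)
  refine ⟨f, f', hfd, fun x => by simp only [hf', hg]; ring, fun x => ?_, ?_⟩
  · have h1 := abs_add_le (x * f x) (g x)
    have h2 : |x * f x| ≤ 2 * A := by
      simp only [hf, mul_neg, abs_neg]; exact hb1 x
    have h3 := hgB x
    simp only [hf']
    linarith
  · have hfc : Continuous f := continuous_iff_continuousAt.2 fun x => (hfd x).continuousAt
    have hd2 : ∀ x ∉ S, HasDerivAt f' (1 * f x + x * f' x + deriv h x) x := fun x hx =>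
      ((hasDerivAt_id x).mul (hfd x)).add ((hd x hx).hasDerivAt.sub_const E)
    refine abs_sub_le_of_abs_deriv_le_off_countable ((continuous_id.mul hfc).add hgc) hS
      (fun x hx => (hd2 x hx).differentiableAt) fun x hx => ?_
    have h1 : deriv f' x = -((1 + x ^ 2) * gaussTail g x - x * g x) + deriv h x := by
      rw [(hd2 x hx).deriv]
      simp only [hf', hf]
      ring
    have h2 := abs_add_le (-((1 + x ^ 2) * gaussTail g x - x * g x)) (deriv h x)
    rw [abs_neg] at h2
    have h3 := hb2 x
    have h4 := hK' x hx
    change |deriv f' x| ≤ _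
    rw [h1]
    linarith

/-- First-order Taylor estimate for a function with Lipschitz derivative. -/
theorem abs_sub_sub_le_of_lipschitz_deriv {f f' : ℝ → ℝ} (hf : ∀ x, HasDerivAt f (f' x) x)
    {L : ℝ} (hL0 : 0 ≤ L) (hL : ∀ a b, |f' b - f' a| ≤ L * |b - a|) (a b : ℝ) :
    |f b - f a - f' a * (b - a)| ≤ L * (b - a) ^ 2 := by
  have h := (convex_uIcc a b).norm_image_sub_le_of_norm_hasDerivWithin_le
    (f := fun x => f x - f' a * x) (f' := fun x => f' x - f' a) (C := L * |b - a|) (x := a)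
    (y := b) (fun x _ => by
      have h1 := (hf x).sub ((hasDerivAt_id x).const_mul (f' a))
      exact (h1.congr_deriv (by simp)).hasDerivWithinAt)
    (fun x hx => (hL a x).trans (mul_le_mul_of_nonneg_left
      (Set.abs_sub_left_of_mem_uIcc hx) hL0))
    Set.left_mem_uIcc Set.right_mem_uIcc
  simp only [Real.norm_eq_abs] at h
  rw [show f b - f a - f' a * (b - a) = f b - f' a * b - (f a - f' a * a) by ring]
  refine h.trans_eq ?_
  rw [mul_assoc, abs_mul_abs_self]
  ring

/-! ### Normal approximation for `q ≤ 1` -/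

theorem mallowsMean_twoSidedDes {m : ℕ} {q : ℝ} (hq : 0 < q) :
    mallowsMean (m + 1) q twoSidedDes = 2 * (q / (1 + q)) * m := by
  have h := mallowsMean_twoSidedDes_sub (m := m) hq (fun _ => 1)
  simp only [mul_one, sub_self, ite_self, mallowsMean_const _ hq, Finset.sum_const_zero,
    mul_zero] at h
  rw [mallowsMean_sub, mallowsMean_const _ hq] at h
  exact sub_eq_zero.1 h

theorem mallowsVar_twoSidedDes {m : ℕ} {q : ℝ} (hq : 0 < q) :
    mallowsVar (m + 1) q twoSidedDes
      = 2 * (q / (1 + q)) * mallowsMean (m + 1) q (fun w => ∑ i, increment i w) := by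
  have h := mallowsMean_twoSidedDes_sub (m := m) hq (fun x => x - 2 * (q / (1 + q)) * m)
  rw [mallowsVar, mallowsMean_twoSidedDes hq, mallowsMean_sum]
  simp only [sq, h, sub_sub_sub_cancel_right]
  rfl

theorem le_mallowsMean_sum_increment {m : ℕ} {q : ℝ} (hq : 0 < q) :
    m * ((1 + q)⁻¹ / 3) ≤ mallowsMean (m + 1) q (fun w => ∑ i, increment i w) := by
  rw [mallowsMean_sum]
  have := Finset.sum_le_sum fun (i : Fin m) (_ : i ∈ Finset.univ) => le_mallowsMean_increment hq i
  simpa using this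

theorem mallowsMean_sum_increment_sq_le {m : ℕ} {q : ℝ} (hq : 0 < q) :
    ∑ i : Fin m, mallowsMean (m + 1) q (fun w => increment i w ^ 2) ≤ m * (4 * (1 + q)⁻¹) := by
  have h : ∀ i ∈ (Finset.univ : Finset (Fin m)),
      mallowsMean (m + 1) q (fun w => increment i w ^ 2) ≤ 4 * (1 + q)⁻¹ := by
    intro i _
    have := mallowsMean_mono (m + 1) hq (fun w => increment_sq_le w i)
    rwa [mallowsMean_const_mul, mallowsMean_ascent hq] at this
  simpa using Finset.sum_le_sum h

theorem le_mallowsVar_twoSidedDes {m : ℕ} {q : ℝ} (hq : 0 < q) (hq1 : q ≤ 1) :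
    q * m / 6 ≤ mallowsVar (m + 1) q twoSidedDes := by
  rw [mallowsVar_twoSidedDes hq]
  have h := le_mallowsMean_sum_increment (m := m) hq
  have hp : 0 ≤ 2 * (q / (1 + q)) := by positivity
  refine le_trans ?_ (mul_le_mul_of_nonneg_left h hp)
  have h1 : 2 * (q / (1 + q)) * (m * ((1 + q)⁻¹ / 3)) = (2 * q * m / 3) / (1 + q) ^ 2 := by
    field_simp
  rw [h1, le_div_iff₀ (by positivity)]
  have : (1 + q) ^ 2 ≤ 4 := by nlinarith
  calc q * m / 6 * (1 + q) ^ 2 ≤ q * m / 6 * 4 := by gcongr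
    _ = 2 * q * m / 3 := by ring

/-- The mean of the Stein discrepancy is controlled by the variance of the conditional mean
increment and by the second moments of the increments. -/
theorem abs_mallowsMean_stein_le {m : ℕ} {q : ℝ} (hq : 0 < q) {f f' : ℝ → ℝ}
    (hf : ∀ x, HasDerivAt f (f' x) x) {B L : ℝ} (hB : ∀ x, |f' x| ≤ B) (hL0 : 0 ≤ L)
    (hL : ∀ a b, |f' b - f' a| ≤ L * |b - a|) {μ σ D : ℝ}
    (hμ : μ = mallowsMean (m + 1) q twoSidedDes) (hσ0 : 0 < σ)
    (hσ : σ ^ 2 = mallowsVar (m + 1) q twoSidedDes)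
    (hD : D = mallowsMean (m + 1) q (fun w => ∑ i, increment i w)) (hD0 : 0 < D) :
    |mallowsMean (m + 1) q (fun w => f' ((twoSidedDes w - μ) / σ)
        - (twoSidedDes w - μ) / σ * f ((twoSidedDes w - μ) / σ))|
      ≤ B * Real.sqrt (mallowsVar (m + 1) q (fun w => ∑ i, increment i w)) / D
        + L * (∑ i : Fin m, mallowsMean (m + 1) q (fun w => increment i w ^ 2)) / (σ * D) := by
  set X : Equiv.Perm (Fin (m + 1)) → ℝ := fun w => (twoSidedDes w - μ) / σ with hX
  set T : Equiv.Perm (Fin (m + 1)) → ℝ := fun w => ∑ i, increment i w with hT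
  set r : Fin m → Equiv.Perm (Fin (m + 1)) → ℝ := fun i w =>
    (if w i.castSucc < w i.succ then f (X (w * adjSwap i)) - f (X w) else 0)
      - f' (X w) * (increment i w / σ) with hr
  set R := ∑ i, mallowsMean (m + 1) q (r i) with hR
  have hB0 : 0 ≤ B := (abs_nonneg _).trans (hB 0)
  -- The Taylor remainder of each exchange.
  have hrle : ∀ i w, |r i w| ≤ L / σ ^ 2 * increment i w ^ 2 := by
    intro i w
    simp only [hr]
    by_cases h : w i.castSucc < w i.succ
    · have e : X (w * adjSwap i) - X w = increment i w / σ := by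
        rw [increment, if_pos h]; simp only [hX]; ring
      rw [if_pos h, ← e]
      refine (abs_sub_sub_le_of_lipschitz_deriv hf hL0 hL _ _).trans_eq ?_
      rw [e]; ring
    · rw [if_neg h, increment, if_neg h]; simp
  have hRle : |R|
      ≤ L / σ ^ 2 * ∑ i : Fin m, mallowsMean (m + 1) q (fun w => increment i w ^ 2) := by
    rw [Finset.mul_sum]
    refine (Finset.abs_sum_le_sum_abs _ _).trans (Finset.sum_le_sum fun i _ => ?_)
    refine (abs_mallowsMean_le _ hq _).trans ?_
    rw [← mallowsMean_const_mul]
    exact mallowsMean_mono _ hq (hrle i)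
  have h2p : 2 * (q / (1 + q)) = σ ^ 2 / D := by
    rw [hσ, mallowsVar_twoSidedDes hq, ← hD]; field_simp
  have hμ' : 2 * (q / (1 + q)) * m = μ := by rw [hμ, mallowsMean_twoSidedDes hq]
  have hXf : mallowsMean (m + 1) q (fun w => X w * f (X w))
      = (mallowsMean (m + 1) q (fun w => f' (X w) * T w)) / D + σ / D * R := by
    have h := mallowsMean_twoSidedDes_sub (m := m) hq (fun x => f ((x - μ) / σ))
    rw [hμ', h2p] at h
    have h1 : mallowsMean (m + 1) q (fun w => X w * f (X w))
        = 1 / σ * mallowsMean (m + 1) q (fun w => (twoSidedDes w - μ) * f (X w)) := by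
      rw [← mallowsMean_const_mul]
      congr 1; ext w; simp only [hX]; ring
    have h2 : ∑ i : Fin m, mallowsMean (m + 1) q
        (fun w => if w i.castSucc < w i.succ then f (X (w * adjSwap i)) - f (X w) else 0)
        = 1 / σ * mallowsMean (m + 1) q (fun w => f' (X w) * T w) + R := by
      rw [hR, ← mallowsMean_const_mul, ← mallowsMean_sum, ← mallowsMean_sum, ← mallowsMean_add]
      congr 1
      ext w
      simp only [hr, Finset.sum_sub_distrib, hT]
      rw [← Finset.mul_sum, ← Finset.sum_div]
      ring
    rw [h1, h, h2]
    field_simp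
  have hmain : mallowsMean (m + 1) q (fun w => f' (X w) - X w * f (X w))
      = -(mallowsMean (m + 1) q (fun w => f' (X w) * (T w - D))) / D - σ / D * R := by
    rw [mallowsMean_sub, hXf]
    have h3 : mallowsMean (m + 1) q (fun w => f' (X w) * (T w - D))
        = mallowsMean (m + 1) q (fun w => f' (X w) * T w)
          - D * mallowsMean (m + 1) q (fun w => f' (X w)) := by
      rw [← mallowsMean_const_mul, ← mallowsMean_sub]
      congr 1; ext w; ring
    rw [h3]
    field_simp
    ring
  have hfirst : |mallowsMean (m + 1) q (fun w => f' (X w) * (T w - D))|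
      ≤ B * Real.sqrt (mallowsVar (m + 1) q T) := by
    refine (abs_mallowsMean_le _ hq _).trans ?_
    have h4 : mallowsMean (m + 1) q (fun w => |f' (X w) * (T w - D)|)
        ≤ B * mallowsMean (m + 1) q (fun w => |T w - D|) := by
      rw [← mallowsMean_const_mul]
      refine mallowsMean_mono _ hq fun w => ?_
      rw [abs_mul]
      exact mul_le_mul_of_nonneg_right (hB _) (abs_nonneg _)
    refine h4.trans (mul_le_mul_of_nonneg_left ?_ hB0)
    refine Real.le_sqrt_of_sq_le ?_
    have h5 := mallowsMean_mul_sq_le (m + 1) hq (fun w => |T w - D|) (fun _ => 1)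
    simpa [mallowsMean_const _ hq, mallowsVar, ← hD] using h5
  rw [hmain]
  refine (abs_sub _ _).trans ?_
  rw [abs_div, abs_neg, abs_of_pos hD0, abs_mul, abs_of_pos (by positivity : 0 < σ / D)]
  refine add_le_add (div_le_div_of_nonneg_right hfirst hD0.le) ?_
  refine (mul_le_mul_of_nonneg_left hRle (by positivity)).trans_eq ?_
  field_simp

theorem abs_mallowsMean_sub_gaussian_le_of_le_one {m : ℕ} (hm : 0 < m) {q : ℝ} (hq : 0 < q)
    (hq1 : q ≤ 1) {h : ℝ → ℝ} (hc : Continuous h) {S : Set ℝ} (hS : S.Countable)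
    (hd : ∀ x ∉ S, DifferentiableAt ℝ h x) {A K : ℝ} (hA : ∀ x, |h x| ≤ A)
    (hK : ∀ x ∉ S, |deriv h x| ≤ K) {μ σ : ℝ}
    (hμ : μ = mallowsMean (m + 1) q twoSidedDes)
    (hσ : σ = Real.sqrt (mallowsVar (m + 1) q twoSidedDes)) :
    |mallowsMean (m + 1) q (fun w => h ((twoSidedDes w - μ) / σ))
        - ∫ z, h z ∂(gaussianReal 0 1)|
      ≤ (331 * A + 167 * K * (Real.sqrt q)⁻¹) * (Real.sqrt m)⁻¹ := by
  have hlip := abs_sub_le_of_abs_deriv_le_off_countable hc hS hd hK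
  have hA0 : 0 ≤ A := (abs_nonneg _).trans (hA 0)
  have hK0 : 0 ≤ K := by
    have := (abs_nonneg _).trans (hlip 0 1)
    simpa using this
  obtain ⟨f, f', hf, hfs, hfB, hfL⟩ := exists_stein_solution hc hS hd hA hlip hK
  have hm0 : (0 : ℝ) < m := by exact_mod_cast hm
  have hvar := le_mallowsVar_twoSidedDes (m := m) hq hq1
  have hvar0 : 0 < mallowsVar (m + 1) q twoSidedDes := lt_of_lt_of_le (by positivity) hvar
  have hσ0 : 0 < σ := by rw [hσ]; exact Real.sqrt_pos.2 hvar0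
  have hσ2 : σ ^ 2 = mallowsVar (m + 1) q twoSidedDes := by
    rw [hσ, Real.sq_sqrt hvar0.le]
  set D := mallowsMean (m + 1) q (fun w => ∑ i, increment i w) with hD
  have hDle := le_mallowsMean_sum_increment (m := m) hq
  rw [← hD] at hDle
  have hq' : 0 < (1 + q)⁻¹ := by positivity
  have hD0 : 0 < D := lt_of_lt_of_le (by positivity) hDle
  have hmean : mallowsMean (m + 1) q (fun w => h ((twoSidedDes w - μ) / σ))
        - ∫ z, h z ∂(gaussianReal 0 1)
      = mallowsMean (m + 1) q (fun w => f' ((twoSidedDes w - μ) / σ)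
        - (twoSidedDes w - μ) / σ * f ((twoSidedDes w - μ) / σ)) := by
    simp only [hfs]
    rw [mallowsMean_sub, mallowsMean_const _ hq]
  rw [hmean]
  refine (abs_mallowsMean_stein_le hq hf hfB (by positivity) hfL hμ hσ0 hσ2 hD hD0).trans ?_
  set s := Real.sqrt m with hs
  set u := Real.sqrt q with hu
  have hs0 : 0 < s := Real.sqrt_pos.2 hm0
  have hu0 : 0 < u := Real.sqrt_pos.2 hq
  have hs2 : s ^ 2 = m := Real.sq_sqrt hm0.le
  have hu2 : u ^ 2 = q := Real.sq_sqrt hq.le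
  -- `D ≥ m / 6`, since `q ≤ 1`.
  have hD6 : s ^ 2 / 6 ≤ D := by
    refine le_trans ?_ hDle
    rw [hs2]
    have : (1 / 2 : ℝ) ≤ (1 + q)⁻¹ := by
      rw [one_div]; exact inv_anti₀ (by positivity) (by linarith)
    nlinarith
  have hfirst : 4 * A * Real.sqrt (mallowsVar (m + 1) q (fun w => ∑ i, increment i w)) / D
      ≤ 331 * A * s⁻¹ := by
    have h1 : Real.sqrt (mallowsVar (m + 1) q (fun w => ∑ i, increment i w)) ≤ 12 * s := by
      refine Real.sqrt_le_iff.2 ⟨by positivity, ?_⟩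
      refine (mallowsVar_sum_increment_le hq hq1 m).trans ?_
      rw [mul_pow, hs2]
      nlinarith
    rw [div_le_iff₀ hD0]
    calc 4 * A * Real.sqrt (mallowsVar (m + 1) q (fun w => ∑ i, increment i w))
        ≤ 4 * A * (12 * s) := by gcongr
      _ ≤ 331 * A * s⁻¹ * (s ^ 2 / 6) := by
        rw [show 331 * A * s⁻¹ * (s ^ 2 / 6) = 331 / 6 * A * s by field_simp]
        nlinarith [mul_nonneg hA0 hs0.le]
      _ ≤ 331 * A * s⁻¹ * D := by gcongr
  have hsecond : 26 / 5 * K * (∑ i : Fin m, mallowsMean (m + 1) q (fun w => increment i w ^ 2))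
      / (σ * D) ≤ 167 * K * u⁻¹ * s⁻¹ := by
    have h1 : ∑ i : Fin m, mallowsMean (m + 1) q (fun w => increment i w ^ 2) ≤ 12 * D := by
      refine (mallowsMean_sum_increment_sq_le hq).trans ?_
      linarith
    -- `σ ≥ √(q m / 6)` and `62.4 √6 ≤ 167`.
    have h2 : 312 / 5 * (u * s) ≤ 167 * σ := by
      have h3 : u ^ 2 * s ^ 2 / 6 ≤ σ ^ 2 := by rw [hσ2, hu2, hs2]; exact hvar
      refine le_of_sq_le_sq ?_ (by positivity)
      nlinarith
    rw [div_le_iff₀ (by positivity)]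
    calc 26 / 5 * K * (∑ i : Fin m, mallowsMean (m + 1) q (fun w => increment i w ^ 2))
        ≤ 26 / 5 * K * (12 * D) := by gcongr
      _ = K * D * u⁻¹ * s⁻¹ * (312 / 5 * (u * s)) := by field_simp; ring
      _ ≤ K * D * u⁻¹ * s⁻¹ * (167 * σ) := by gcongr
      _ = 167 * K * u⁻¹ * s⁻¹ * (σ * D) := by ring
  rw [add_mul]
  exact add_le_add hfirst hsecond

/-! ### Reversal -/

theorem des_mul_rev {m : ℕ} (w : Equiv.Perm (Fin (m + 1))) :
    (des (w * Fin.revPerm) : ℝ) = m - des w := by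
  have h : (des (w * Fin.revPerm) : ℝ) + des w = m := by
    rw [des_eq_sum, des_eq_sum, ← Equiv.sum_comp Fin.revPerm, ← Finset.sum_add_distrib]
    have : ∀ i : Fin m, ((if (w * Fin.revPerm : Equiv.Perm (Fin (m + 1))) (Fin.revPerm i).succ
        < (w * Fin.revPerm : Equiv.Perm (Fin (m + 1))) (Fin.revPerm i).castSucc then (1 : ℝ) else 0)
        + if w i.succ < w i.castSucc then 1 else 0) = 1 := by
      intro i
      have e1 : Fin.rev i.rev.succ = i.castSucc := by rw [Fin.rev_succ, Fin.rev_rev]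
      have e2 : Fin.rev i.rev.castSucc = i.succ := by rw [Fin.rev_castSucc, Fin.rev_rev]
      simp only [Equiv.Perm.coe_mul, Function.comp_apply, Fin.revPerm_apply, e1, e2]
      have : w i.succ ≠ w i.castSucc := fun h => by simpa [Fin.ext_iff] using w.injective h
      rcases lt_or_gt_of_ne this with h | h <;> simp [h, h.le]
    rw [Finset.sum_congr rfl fun i _ => this i]
    simp
  linarith

theorem des_rev_mul {m : ℕ} (w : Equiv.Perm (Fin (m + 1))) :
    (des (Fin.revPerm * w) : ℝ) = m - des w := by
  have h : (des (Fin.revPerm * w) : ℝ) + des w = m := by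
    rw [des_eq_sum, des_eq_sum, ← Finset.sum_add_distrib]
    have : ∀ i : Fin m, ((if (Fin.revPerm * w : Equiv.Perm (Fin (m + 1))) i.succ
        < (Fin.revPerm * w : Equiv.Perm (Fin (m + 1))) i.castSucc then (1 : ℝ) else 0)
        + if w i.succ < w i.castSucc then 1 else 0) = 1 := by
      intro i
      simp only [Equiv.Perm.coe_mul, Function.comp_apply, Fin.revPerm_apply, Fin.rev_lt_rev]
      have : w i.succ ≠ w i.castSucc := fun h => by simpa [Fin.ext_iff] using w.injective h
      rcases lt_or_gt_of_ne this with h | h <;> simp [h, h.le]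
    rw [Finset.sum_congr rfl fun i _ => this i]
    simp
  linarith

theorem twoSidedDes_mul_rev {m : ℕ} (w : Equiv.Perm (Fin (m + 1))) :
    twoSidedDes (w * Fin.revPerm) = 2 * m - twoSidedDes w := by
  have h : (w * Fin.revPerm)⁻¹ = Fin.revPerm * w⁻¹ := by
    rw [mul_inv_rev]; rfl
  rw [twoSidedDes, h, des_mul_rev, des_rev_mul, twoSidedDes]
  ring

/-- The normal approximation for all `q`: reversal reduces `q > 1` to `q⁻¹ < 1`. -/
theorem abs_mallowsMean_sub_gaussian_le {m : ℕ} (hm : 0 < m) {q : ℝ} (hq : 0 < q)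
    {h : ℝ → ℝ} (hc : Continuous h) {S : Set ℝ} (hS : S.Countable)
    (hd : ∀ x ∉ S, DifferentiableAt ℝ h x) {A K : ℝ} (hA : ∀ x, |h x| ≤ A) (hK0 : 0 ≤ K)
    (hK : ∀ x ∉ S, |deriv h x| ≤ K) {μ σ : ℝ}
    (hμ : μ = mallowsMean (m + 1) q twoSidedDes)
    (hσ : σ = Real.sqrt (mallowsVar (m + 1) q twoSidedDes)) :
    |mallowsMean (m + 1) q (fun w => h ((twoSidedDes w - μ) / σ))
        - ∫ z, h z ∂(gaussianReal 0 1)|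
      ≤ (331 * A + 167 * K * max (Real.sqrt q)⁻¹ (Real.sqrt q)) * (Real.sqrt m)⁻¹ := by
  rcases le_total q 1 with hq1 | hq1
  · refine (abs_mallowsMean_sub_gaussian_le_of_le_one hm hq hq1 hc hS hd hA hK hμ hσ).trans ?_
    gcongr
    exact le_max_left _ _
  · set μ' := mallowsMean (m + 1) q⁻¹ twoSidedDes with hμ'
    have e1 : μ = 2 * m - μ' := by
      rw [hμ, ← mallowsMean_mul_rev (m + 1) hq twoSidedDes, hμ']
      simp only [twoSidedDes_mul_rev]
      rw [mallowsMean_sub, mallowsMean_const _ (inv_pos.2 hq)]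
    have e2 : mallowsVar (m + 1) q twoSidedDes = mallowsVar (m + 1) q⁻¹ twoSidedDes := by
      rw [mallowsVar, mallowsVar, ← hμ, ← mallowsMean_mul_rev (m + 1) hq, ← hμ', e1]
      simp only [twoSidedDes_mul_rev]
      congr 1; ext w; ring
    have e3 : mallowsMean (m + 1) q (fun w => h ((twoSidedDes w - μ) / σ))
        = mallowsMean (m + 1) q⁻¹ (fun w => h (-((twoSidedDes w - μ') / σ))) := by
      rw [← mallowsMean_mul_rev (m + 1) hq, e1]
      simp only [twoSidedDes_mul_rev]
      congr 1; ext w; congr 1; ring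
    have e4 : ∫ z, h z ∂(gaussianReal 0 1) = ∫ z, h (-z) ∂(gaussianReal 0 1) := by
      conv_lhs => rw [← neg_zero (G := ℝ), ← gaussianReal_map_neg]
      rw [integral_map measurable_neg.aemeasurable hc.aestronglyMeasurable]
    have hd' : ∀ x ∉ Neg.neg ⁻¹' S, DifferentiableAt ℝ (fun x => h (-x)) x := fun x hx =>
      (hd (-x) hx).comp x differentiable_neg.differentiableAt
    have hK' : ∀ x ∉ Neg.neg ⁻¹' S, |deriv (fun x => h (-x)) x| ≤ K := fun x hx => by
      rw [deriv_comp_neg, abs_neg]; exact hK (-x) hx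
    rw [e3, e4]
    refine (abs_mallowsMean_sub_gaussian_le_of_le_one hm (inv_pos.2 hq) (inv_le_one_of_one_le₀ hq1)
      (hc.comp continuous_neg) (hS.preimage neg_injective) hd' (fun x => hA (-x)) hK' hμ'
      (hσ.trans (by rw [e2]))).trans ?_
    rw [Real.sqrt_inv, inv_inv]
    gcongr
    exact le_max_right _ _

/-! ### Random permutations and piecewise `C¹` test functions -/

theorem integral_mallowsMeasure (n : ℕ) {q : ℝ} (hq : 0 < q) (g : Equiv.Perm (Fin n) → ℝ) :
    ∫ v, g v ∂(mallowsMeasure n q) = mallowsMean n q g := by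
  have hZ := partitionFunction_pos n hq
  have hint : ∀ v ∈ (Finset.univ : Finset (Equiv.Perm (Fin n))), Integrable g
      (ENNReal.ofReal (q ^ inversions v / partitionFunction n q) • Measure.dirac v) :=
    fun v _ => (integrable_dirac (by simp)).smul_measure ENNReal.ofReal_ne_top
  rw [mallowsMeasure, integral_finsetSum_measure hint, mallowsMean, Finset.sum_div]
  refine Finset.sum_congr rfl fun v _ => ?_
  rw [integral_smul_measure, integral_dirac, ENNReal.toReal_ofReal (by positivity), smul_eq_mul]
  ring

theorem integral_comp_of_hasLaw {Ω : Type*} [MeasurableSpace Ω] {P : Measure Ω} {n : ℕ} {q : ℝ}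
    (hq : 0 < q) {w : Ω → Equiv.Perm (Fin n)} (hw : HasLaw w (mallowsMeasure n q) P)
    (g : Equiv.Perm (Fin n) → ℝ) : ∫ ω, g (w ω) ∂P = mallowsMean n q g := by
  rw [← integral_mallowsMeasure n hq]
  exact hw.integral_comp (measurable_from_top (f := g)).aestronglyMeasurable

theorem IsPiecewiseC1.exists_countable {h : ℝ → ℝ} (hh : IsPiecewiseC1 h) :
    ∃ S : Set ℝ, S.Countable ∧ ∀ x ∉ S, DifferentiableAt ℝ h x := by
  obtain ⟨-, S, hS, hd⟩ := hh
  refine ⟨S, ?_, fun x hx => ?_⟩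
  · have : S = ⋃ k : ℕ, S ∩ Set.Icc (-(k : ℝ)) k := by
      rw [← Set.inter_iUnion]
      symm
      refine Set.inter_eq_left.2 fun x _ => ?_
      obtain ⟨k, hk⟩ := exists_nat_ge |x|
      exact Set.mem_iUnion.2 ⟨k, abs_le.1 hk⟩
    rw [this]
    exact Set.countable_iUnion fun k => (hS _ _).countable
  · have h1 : (S ∩ Set.Icc (x - 1) (x + 1))ᶜ ∈ nhds x :=
      (hS _ _).isClosed.isOpen_compl.mem_nhds fun hx' => hx hx'.1
    have h2 : Set.Icc (x - 1) (x + 1) ∈ nhds x := Icc_mem_nhds (by linarith) (by linarith)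
    have h3 : Sᶜ ∈ nhds x := by
      filter_upwards [h1, h2] with y hy1 hy2 hy
      exact hy1 ⟨hy, hy2⟩
    exact (hd.differentiableOn one_ne_zero).differentiableAt h3

theorem abs_le_toReal_of_enorm_le {x : ℝ} {M : ℝ≥0∞} (hM : M ≠ ⊤) (h : ‖x‖ₑ ≤ M) :
    |x| ≤ M.toReal := by
  rw [← Real.norm_eq_abs, ← toReal_enorm]
  exact ENNReal.toReal_mono hM h

end Mallows

theorem theorem1p1 {Ω : Type*} [MeasurableSpace Ω] (P : Measure Ω) [IsProbabilityMeasure P]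
    (n : ℕ) (hn : 2 ≤ n) (q : ℝ) (hq : 0 < q)
    (w : Ω → Equiv.Perm (Fin n)) (hw : HasLaw w (Mallows.mallowsMeasure n q) P)
    (μ σ : ℝ) (hμ : μ = ∫ ω, Mallows.twoSidedDes (w ω) ∂P)
    (hσ : σ = Real.sqrt (variance (fun ω => Mallows.twoSidedDes (w ω)) P))
    (h : ℝ → ℝ) (hh : Mallows.IsPiecewiseC1 h) :
    ENNReal.ofReal
        |(∫ ω, h ((Mallows.twoSidedDes (w ω) - μ) / σ) ∂P) - ∫ z, h z ∂(gaussianReal 0 1)|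
      ≤ (331 * Mallows.supNorm h
          + 167 * Mallows.supNormDeriv h
            * ENNReal.ofReal (max (q ^ (-(1 / 2) : ℝ)) (q ^ (1 / 2 : ℝ))))
        * ENNReal.ofReal (((n : ℝ) - 1) ^ (-(1 / 2) : ℝ)) := by
  obtain ⟨m, rfl⟩ : ∃ m, n = m + 1 := ⟨n - 1, by omega⟩
  have hm : 0 < m := by omega
  have hm0 : (0 : ℝ) < m := by exact_mod_cast hm
  have hcast : ((m + 1 : ℕ) : ℝ) - 1 = m := by push_cast; ring
  have hrate : 0 < (m : ℝ) ^ (-(1 / 2) : ℝ) := Real.rpow_pos_of_pos hm0 _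
  have hmax : 0 < max (q ^ (-(1 / 2) : ℝ)) (q ^ (1 / 2 : ℝ)) :=
    lt_max_of_lt_left (Real.rpow_pos_of_pos hq _)
  rw [hcast]
  -- The bound is void if one of the two suprema is infinite.
  by_cases hAtop : Mallows.supNorm h = ⊤
  · rw [hAtop, ENNReal.mul_top (by norm_num), top_add,
      ENNReal.top_mul (ENNReal.ofReal_pos.2 hrate).ne']
    exact le_top
  by_cases hKtop : Mallows.supNormDeriv h = ⊤
  · rw [hKtop, ENNReal.mul_top (by norm_num), ENNReal.top_mul (ENNReal.ofReal_pos.2 hmax).ne',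
      add_top, ENNReal.top_mul (ENNReal.ofReal_pos.2 hrate).ne']
    exact le_top
  obtain ⟨S, hS, hd⟩ := hh.exists_countable
  set A := (Mallows.supNorm h).toReal with hA
  set K := (Mallows.supNormDeriv h).toReal with hK
  have hAle : ∀ x, |h x| ≤ A := fun x =>
    Mallows.abs_le_toReal_of_enorm_le hAtop (le_iSup (fun x => ‖h x‖ₑ) x)
  have hKle : ∀ x ∉ S, |deriv h x| ≤ K := fun x hx =>
    Mallows.abs_le_toReal_of_enorm_le hKtop
      (le_iSup₂ (f := fun (x : ℝ) (_ : DifferentiableAt ℝ h x) => ‖deriv h x‖ₑ) x (hd x hx))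
  rw [Mallows.integral_comp_of_hasLaw hq hw] at hμ
  have hvar : variance (fun ω => Mallows.twoSidedDes (w ω)) P
      = Mallows.mallowsVar (m + 1) q Mallows.twoSidedDes := by
    have hmeas : AEMeasurable (fun ω => Mallows.twoSidedDes (w ω)) P :=
      (measurable_from_top (f := Mallows.twoSidedDes)).comp_aemeasurable hw.aemeasurable
    rw [variance_eq_integral hmeas,
      Mallows.integral_comp_of_hasLaw hq hw,
      Mallows.integral_comp_of_hasLaw hq hw
        (fun v => (Mallows.twoSidedDes v - Mallows.mallowsMean (m + 1) q Mallows.twoSidedDes) ^ 2),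
      Mallows.mallowsVar]
  rw [hvar] at hσ
  rw [Mallows.integral_comp_of_hasLaw hq hw (fun v => h ((Mallows.twoSidedDes v - μ) / σ))]
  have key := Mallows.abs_mallowsMean_sub_gaussian_le hm hq hh.1 hS hd hAle
    ENNReal.toReal_nonneg hKle hμ hσ
  have e1 : q ^ (-(1 / 2) : ℝ) = (Real.sqrt q)⁻¹ := by
    rw [Real.rpow_neg hq.le, Real.sqrt_eq_rpow]
  have e2 : (m : ℝ) ^ (-(1 / 2) : ℝ) = (Real.sqrt m)⁻¹ := by
    rw [Real.rpow_neg hm0.le, Real.sqrt_eq_rpow]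
  have hA0 : 0 ≤ A := ENNReal.toReal_nonneg
  have hK0 : 0 ≤ K := ENNReal.toReal_nonneg
  refine (ENNReal.ofReal_le_ofReal key).trans_eq ?_
  rw [← ENNReal.ofReal_toReal hAtop, ← ENNReal.ofReal_toReal hKtop, ← hA, ← hK, e2,
    ENNReal.ofReal_mul (by positivity), ENNReal.ofReal_add (by positivity) (by positivity),
    ENNReal.ofReal_mul (by norm_num), ENNReal.ofReal_mul (by positivity),
    ENNReal.ofReal_mul (by norm_num), e1, Real.sqrt_eq_rpow]
  norm_num
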